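/- Let $p\ge 7$ be a prime, let $\overline{\mathbb Z}_p$ be the ring of integers of $\overline{\mathbb Q}_p$ and $\overline{\mathbb F}_p$ its residue field, and let $\nu$ be the valuation of $\overline{\mathbb Q}_p$ with $\nu(p)=1$. Put $G=\mathrm{GL}_2(\mathbb Q_p)$, $K=\mathrm{GL}_2(\mathbb Z_p)$, and let $Z$ be the centre of $G$. For a $\mathbb Z_p$-algebra $R$ let $\mathrm{Sym}^rR^2$ be the $KZ$-module of homogeneous polynomials of degree $r$ in $x,y$ over $R$, where $\begin{pmatrix}a&b\\c&d\end{pmatrix}\in K$ acts by $f(x,y)\mapsto f(ax+cy,bx+dy)$ and $p\in Z$ acts trivially; put $V_r=\mathrm{Sym}^r\overline{\mathbb F}_p^2$. Let $\mathrm{ind}_{KZ}^G$ denote compact induction (functions $f:G\to W$ with $f(\kappa g)=\kappa f(g)$ for $\kappa\in KZ$ and support compact modulo $KZ$, with $G$ acting by right translation). Let $T$ be the Hecke operator on $\mathrm{ind}_{KZ}^G\mathrm{Sym}^rR^2$ given by $(Tf)(g)=\sum_\delta\delta\cdot f(\delta^{-1}g)$, where $\delta$ runs over the matrices $\begin{pmatrix}p&[\lambda]\\0&1\end{pmatrix}$,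 $\lambda\in\mathbb F_p$ (with $[\lambda]$ the Teichmüller representative), and $\begin{pmatrix}1&0\\0&p\end{pmatrix}$, acting on polynomials by the same formula as above. For $0\neq a_p\in\overline{\mathbb Q}_p$ with $\nu(a_p)>0$ let $\Theta_{r+2,a_p}$ be the image of $\mathrm{ind}_{KZ}^G\mathrm{Sym}^r\overline{\mathbb Z}_p^2$ in $\mathrm{ind}_{KZ}^G\mathrm{Sym}^r\overline{\mathbb Q}_p^2/(T-a_p)$, let $\bar\Theta_{r+2,a_p}=\Theta_{r+2,a_p}\otimes_{\overline{\mathbb Z}_p}\overline{\mathbb F}_p$, and let $P:\mathrm{ind}_{KZ}^GV_r\to\bar\Theta_{r+2,a_p}$ be the natural surjection, which sends the reduction of $f\in \mathrm{ind}_{KZ}^G\mathrm{Sym}^r\overline{\mathbb Z}_p^2$ to the class of $f$. For $m\ge0$ let $V_r^{(m)}\subseteq V_r$ be the subrepresentation of polynomials divisible by $\theta^m$, where $\theta=x^py-xy^p$. Let $2\le b\le p$ and $0\le c\le p-2$ be integers, and put $\epsilon=0$ if $2c-1\le b\le p$, $\epsilon=1$ if $2(c-1)-p\le b\le 2(c-1)$,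 and $\epsilon=2$ if $2\le b\le 2(c-1)-(p+1)$. Let $s=b+c(p-1)$ and $r=s+p^t(p-1)d$ with natural numbers $t,d$ such that $p\nmid d$. Assume that $s\ge 2c$, $c<\nu(a_p)<p-1$ and $t\ge 2\nu(a_p)$. Then $P$ induces a surjection of $G$-representations $$\mathrm{ind}_{KZ}^G\left(\frac{V_r^{(c-\epsilon)}}{V_r^{(\lfloor\nu(a_p)\rfloor+1)}}\right)\twoheadrightarrow\bar\Theta_{r+2,a_p};$$ that is, there is a surjective $G$-equivariant $\overline{\mathbb F}_p$-linear map whose composition with the projection from $\mathrm{ind}_{KZ}^GV_r^{(c-\epsilon)}$ is the restriction of $P$ to $\mathrm{ind}_{KZ}^GV_r^{(c-\epsilon)}$. -/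

import Mathlib

open MvPolynomial
open scoped Valued TensorProduct Matrix MatrixGroups

noncomputable section

namespace LocalConstancy

/-! ### Groups, symmetric powers and compact induction -/

section Groups

variable (p : ℕ) [Fact p.Prime]

/-- `G = GL₂(ℚ_p)`. -/
abbrev G : Type := GL (Fin 2) ℚ_[p]

/-- `K = GL₂(ℤ_p)`. -/
abbrev K : Type := GL (Fin 2) ℤ_[p]

/-- The inclusion `K → G`. -/
def toG : K p →* G p := Matrix.GeneralLinearGroup.map PadicInt.Coe.ringHom

lemma padic_p_ne_zero : (p : ℚ_[p]) ≠ 0 := by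
  exact_mod_cast (Fact.out : p.Prime).ne_zero

/-- The central element `p` of `G`. The centre `Z` of `G` is `ℚ_p^× = p^ℤ × ℤ_p^×`, so that
`KZ = K × p^ℤ`. -/
def pZ : G p := Matrix.GeneralLinearGroup.scalar (Fin 2) (Units.mk0 (p : ℚ_[p]) (padic_p_ne_zero p))

lemma toG_val (κ : K p) (i j : Fin 2) : (toG p κ).1 i j = ((κ.1 i j : ℤ_[p]) : ℚ_[p]) := rfl

lemma toG_injective : Function.Injective (toG p) := by
  intro a b h
  ext i j
  have := congrArg (fun g : G p => g.1 i j) h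
  exact Subtype.ext this

lemma pZ_val : (pZ p).1 = (p : ℚ_[p]) • (1 : Matrix (Fin 2) (Fin 2) ℚ_[p]) := by
  rw [Matrix.smul_one_eq_diagonal]
  rfl

lemma pZ_comm (g : G p) : pZ p * g = g * pZ p := by
  apply Units.ext
  simp [pZ_val]

lemma pZ_zpow_comm (n : ℤ) (g : G p) : pZ p ^ n * g = g * pZ p ^ n :=
  (Commute.zpow_left (show Commute (pZ p) g from pZ_comm p g) n).eq

lemma norm_det_toG (κ : K p) : ‖((toG p κ).det : ℚ_[p])‖ = 1 := by
  have h : ((toG p κ).det : ℚ_[p]) = ((κ.det : ℤ_[p]) : ℚ_[p]) := by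
    simp [Matrix.GeneralLinearGroup.val_det_apply, Matrix.det_fin_two, toG_val]
  rw [h, PadicInt.padic_norm_e_of_padicInt]
  exact PadicInt.norm_units κ.det

lemma norm_det_pZ : ‖((pZ p).det : ℚ_[p])‖ = ((p : ℝ) ^ 2)⁻¹ := by
  rw [Matrix.GeneralLinearGroup.val_det_apply, pZ_val]
  simp

/-- `K ∩ p^ℤ = 1`. -/
lemma decomp_unique {κ κ' : K p} {n n' : ℤ} (h : toG p κ * pZ p ^ n = toG p κ' * pZ p ^ n') :
    κ = κ' := by
  have hd : ‖((toG p κ * pZ p ^ n).det : ℚ_[p])‖ = ‖((toG p κ' * pZ p ^ n').det : ℚ_[p])‖ := by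
    rw [h]
  have hp1 : (1 : ℝ) < p := by exact_mod_cast (Fact.out : p.Prime).one_lt
  have hn : n = n' := by
    simp only [map_mul, map_zpow, Units.val_mul, Units.val_zpow_eq_zpow_val, norm_mul, norm_zpow,
      norm_det_toG, norm_det_pZ, one_mul] at hd
    refine zpow_right_injective₀ (a := ((p : ℝ) ^ 2)⁻¹) (by positivity) ?_ hd
    have : (1 : ℝ) < (p : ℝ) ^ 2 := by nlinarith
    exact (inv_lt_one_of_one_lt₀ this).ne
  subst hn
  exact toG_injective p (mul_right_cancel h)

end Groups

section CompactInduction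

variable {p : ℕ} [Fact p.Prime]

/-- `InCoset x s` says that `x` lies in the coset `KZ s`. -/
def InCoset (x s : G p) : Prop := ∃ (κ : K p) (n : ℤ), x = toG p κ * pZ p ^ n * s

lemma InCoset.refl (s : G p) : InCoset s s := ⟨1, 0, by simp⟩

lemma InCoset.mul_right {x s : G p} (h : InCoset x s) (g : G p) : InCoset (x * g) (s * g) := by
  obtain ⟨κ, n, rfl⟩ := h
  exact ⟨κ, n, by simp [mul_assoc]⟩

lemma InCoset.trans {x y z : G p} (h : InCoset x y) (h' : InCoset y z) : InCoset x z := by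
  obtain ⟨κ, n, rfl⟩ := h
  obtain ⟨κ', n', rfl⟩ := h'
  refine ⟨κ * κ', n + n', ?_⟩
  rw [map_mul, zpow_add]
  have := pZ_zpow_comm p n (toG p κ')
  calc toG p κ * pZ p ^ n * (toG p κ' * pZ p ^ n' * z)
      = toG p κ * (pZ p ^ n * toG p κ') * pZ p ^ n' * z := by simp only [mul_assoc]
    _ = _ := by rw [this]; simp only [mul_assoc]

lemma InCoset.left_toG (κ : K p) (s : G p) : InCoset (toG p κ * s) s := ⟨κ, 0, by simp⟩

lemma InCoset.left_pZ (s : G p) : InCoset (pZ p * s) s := ⟨1, 1, by simp⟩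

lemma InCoset.symm {x y : G p} (h : InCoset x y) : InCoset y x := by
  obtain ⟨κ, n, rfl⟩ := h
  refine ⟨κ⁻¹, -n, ?_⟩
  rw [map_inv, mul_assoc, ← mul_assoc (pZ p ^ (-n)), pZ_zpow_comm p (-n)]
  simp [zpow_neg, mul_assoc]

variable {k W : Type*} [CommRing k] [AddCommGroup W] [Module k W]

/-- The compact induction `ind_{KZ}^G W` of a representation `ρ` of `K` on `W`, extended to `KZ` by
letting `p` act trivially: the functions `f : G → W` with `f (κ g) = κ · f g` for `κ ∈ KZ` whose
support is compact modulo `KZ`, that is, contained in finitely many cosets `KZ s` (these are open).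
-/
def ind (ρ : Representation k (K p) W) : Submodule k (G p → W) where
  carrier := {f | (∀ (κ : K p) (g : G p), f (toG p κ * g) = ρ κ (f g)) ∧
    (∀ g : G p, f (pZ p * g) = f g) ∧
    ∃ S : Set (G p), S.Finite ∧ ∀ g, f g ≠ 0 → ∃ s ∈ S, InCoset g s}
  add_mem' := by
    rintro f f' ⟨h1, h2, S, hS, h3⟩ ⟨h1', h2', S', hS', h3'⟩
    refine ⟨fun κ g => by simp [h1, h1'], fun g => by simp [h2, h2'], S ∪ S', hS.union hS',
      fun g hg => ?_⟩
    by_cases hf : f g = 0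
    · have : f' g ≠ 0 := fun h => hg (by simp [hf, h])
      obtain ⟨s, hs, h⟩ := h3' g this
      exact ⟨s, Or.inr hs, h⟩
    · obtain ⟨s, hs, h⟩ := h3 g hf
      exact ⟨s, Or.inl hs, h⟩
  zero_mem' := ⟨by simp, by simp, ∅, Set.finite_empty, by simp⟩
  smul_mem' := by
    rintro a f ⟨h1, h2, S, hS, h3⟩
    refine ⟨fun κ g => by simp [h1], fun g => by simp [h2], S, hS, fun g hg => h3 g ?_⟩
    intro h
    exact hg (by simp [h])

lemma ind_toG {ρ : Representation k (K p) W} (f : ind ρ) (κ : K p) (g : G p) :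
    f.1 (toG p κ * g) = ρ κ (f.1 g) := f.2.1 κ g

lemma ind_pZ {ρ : Representation k (K p) W} (f : ind ρ) (g : G p) : f.1 (pZ p * g) = f.1 g :=
  f.2.2.1 g

lemma ind_pZ_zpow {ρ : Representation k (K p) W} (f : ind ρ) (n : ℤ) (g : G p) :
    f.1 (pZ p ^ n * g) = f.1 g := by
  induction n using Int.induction_on generalizing g with
  | zero => simp
  | succ n ih => rw [zpow_add_one, mul_assoc, ih, ind_pZ]
  | pred n ih =>
    rw [zpow_sub_one, mul_assoc, ih, ← ind_pZ f ((pZ p)⁻¹ * g), mul_inv_cancel_left]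

lemma ind_kz {ρ : Representation k (K p) W} (f : ind ρ) (κ : K p) (n : ℤ) (g : G p) :
    f.1 (toG p κ * pZ p ^ n * g) = ρ κ (f.1 g) := by
  rw [mul_assoc, ind_toG, ind_pZ_zpow]

/-- `G` acts on `ind_{KZ}^G W` by right translation: `(g · f) x = f (x g)`. -/
def indRep (ρ : Representation k (K p) W) : Representation k (G p) (ind ρ) where
  toFun g :=
    { toFun := fun f => ⟨fun x => f.1 (x * g), fun κ x => by
        simp only [mul_assoc, ind_toG], fun x => by simp only [mul_assoc, ind_pZ], by
          obtain ⟨S, hS, h⟩ := f.2.2.2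
          refine ⟨(fun s => s * g⁻¹) '' S, hS.image _, fun x hx => ?_⟩
          obtain ⟨s, hs, hxs⟩ := h _ hx
          exact ⟨_, ⟨s, hs, rfl⟩, by simpa using hxs.mul_right g⁻¹⟩⟩
      map_add' := fun _ _ => rfl
      map_smul' := fun _ _ => rfl }
  map_one' := by ext f x; simp
  map_mul' g h := by ext f x; simp [mul_assoc]

@[simp] lemma indRep_apply (ρ : Representation k (K p) W) (g x : G p) (f : ind ρ) :
    (indRep ρ g f).1 x = f.1 (x * g) := rfl

/-- Functoriality of compact induction along a (semilinear) `K`-equivariant map. -/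
def indMap {k' W' : Type*} [CommRing k'] [AddCommGroup W'] [Module k' W'] {σ : k →+* k'}
    {ρ : Representation k (K p) W} {ρ' : Representation k' (K p) W'} (L : W →ₛₗ[σ] W')
    (hL : ∀ κ w, L (ρ κ w) = ρ' κ (L w)) : ind ρ →ₛₗ[σ] ind ρ' where
  toFun f := ⟨fun g => L (f.1 g), fun κ g => by simp only [ind_toG, hL],
    fun g => by simp only [ind_pZ], by
    obtain ⟨S, hS, h⟩ := f.2.2.2
    exact ⟨S, hS, fun g hg => h g fun h0 => hg (by simp [h0])⟩⟩
  map_add' f f' := by ext g; simp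
  map_smul' a f := by ext g; simp

@[simp] lemma indMap_apply {k' W' : Type*} [CommRing k'] [AddCommGroup W'] [Module k' W']
    {σ : k →+* k'} {ρ : Representation k (K p) W} {ρ' : Representation k' (K p) W'}
    (L : W →ₛₗ[σ] W') (hL : ∀ κ w, L (ρ κ w) = ρ' κ (L w)) (f : ind ρ) (g : G p) :
    (indMap (ρ := ρ) (ρ' := ρ') L hL f).1 g = L (f.1 g) := rfl

open Classical in
/-- The function `[g, v]`, with `[g, v] x = (x g) · v` if `x ∈ KZ g⁻¹` and `0` otherwise. -/
def bracketFun (ρ : Representation k (K p) W) (g : G p) (v : W) (x : G p) : W :=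
  if h : InCoset x g⁻¹ then ρ h.choose v else 0

lemma bracketFun_kz (ρ : Representation k (K p) W) (g : G p) (v : W) (κ : K p) (n : ℤ) :
    bracketFun ρ g v (toG p κ * pZ p ^ n * g⁻¹) = ρ κ v := by
  have h : InCoset (toG p κ * pZ p ^ n * g⁻¹) g⁻¹ := ⟨κ, n, rfl⟩
  rw [bracketFun, dif_pos h]
  obtain ⟨m, hm⟩ := h.choose_spec
  exact congrArg (fun κ => ρ κ v) (decomp_unique p (mul_right_cancel hm)).symm

lemma bracketFun_of_not (ρ : Representation k (K p) W) (g : G p) (v : W) {x : G p}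
    (h : ¬ InCoset x g⁻¹) : bracketFun ρ g v x = 0 := by
  rw [bracketFun, dif_neg h]

/-- The element `[g, v]` of `ind_{KZ}^G W`. -/
def bracket (ρ : Representation k (K p) W) (g : G p) : W →ₗ[k] ind ρ where
  toFun v := ⟨bracketFun ρ g v, by
    refine ⟨fun κ x => ?_, fun x => ?_, {g⁻¹}, Set.finite_singleton _, fun x hx => ?_⟩
    · by_cases h : InCoset x g⁻¹
      · obtain ⟨κ', n, rfl⟩ := h
        rw [← mul_assoc, ← mul_assoc, ← map_mul, bracketFun_kz, bracketFun_kz, map_mul]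
        rfl
      · rw [bracketFun_of_not _ _ _ h, bracketFun_of_not, map_zero]
        exact fun h' => h ((InCoset.left_toG κ x).symm.trans h')
    · by_cases h : InCoset x g⁻¹
      · obtain ⟨κ', n, rfl⟩ := h
        rw [← mul_assoc, ← mul_assoc, pZ_comm, mul_assoc (toG p κ'), ← zpow_one_add, bracketFun_kz,
          bracketFun_kz]
      · rw [bracketFun_of_not _ _ _ h, bracketFun_of_not]
        exact fun h' => h ((InCoset.left_pZ x).symm.trans h')
    · by_contra hc
      exact hx (bracketFun_of_not _ _ _ fun h => hc ⟨_, rfl, h⟩)⟩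
  map_add' v w := by
    ext x
    by_cases h : InCoset x g⁻¹
    · obtain ⟨κ', n, rfl⟩ := h
      simp [bracketFun_kz]
    · simp [bracketFun_of_not _ _ _ h]
  map_smul' a w := by
    ext x
    by_cases h : InCoset x g⁻¹
    · obtain ⟨κ', n, rfl⟩ := h
      simp [bracketFun_kz]
    · simp [bracketFun_of_not _ _ _ h]

/-- An element of the compact induction all of whose values satisfy a property `N` that is inherited
by `K`-translates is a finite sum of elements `[g, v]` with `N v`. -/
lemma ind_induction {ρ : Representation k (K p) W} (N : W → Prop) {M : ind ρ → Prop}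
    (zero : M 0) (add : ∀ (f : ind ρ) g v, N v → M f → M (f + bracket ρ g v))
    (f : ind ρ) (hf : ∀ g, N (f.1 g)) (hN0 : N 0) : M f := by
  obtain ⟨S, hS, h⟩ := f.2.2.2
  induction S, hS using Set.Finite.induction_on generalizing f with
  | empty =>
    have : f = 0 := by
      ext g
      by_contra hg
      obtain ⟨s, hs, -⟩ := h g hg
      exact hs
    rwa [this]
  | @insert s S hs hS ih =>
    have hval : ∀ x, InCoset x s → (bracket ρ s⁻¹ (f.1 s)).1 x = f.1 x := by
      rintro x ⟨κ, n, rfl⟩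
      have := bracketFun_kz ρ s⁻¹ (f.1 s) κ n
      rw [inv_inv] at this
      rw [ind_kz f]
      exact this
    have hval' : ∀ x, ¬ InCoset x s → (bracket ρ s⁻¹ (f.1 s)).1 x = 0 := by
      intro x hx
      exact bracketFun_of_not _ _ _ (by rwa [inv_inv])
    have key := add (f - bracket ρ s⁻¹ (f.1 s)) s⁻¹ (f.1 s) (hf s) (ih _ ?_ ?_)
    · simpa using key
    · intro g
      by_cases hg : InCoset g s
      · simpa [hval g hg] using hN0
      · simpa [hval' g hg] using hf g
    · intro g hg
      by_cases hgs : InCoset g s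
      · exact absurd (by simp [hval g hgs]) hg
      · have hg' : f.1 g ≠ 0 := by simpa [hval' g hgs] using hg
        obtain ⟨s', hs', h'⟩ := h g hg'
        rcases hs' with rfl | hs'
        · exact absurd h' hgs
        · exact ⟨s', hs', h'⟩

end CompactInduction

section SymmetricPowers

/-- `Sym^r R²`, modelled on the homogeneous polynomials of degree `r` in `x = X 0` and `y = X 1`. -/
def SymPow (R : Type*) [CommRing R] (r : ℕ) : Type _ := ↥(homogeneousSubmodule (Fin 2) R r)

variable {R S : Type*} [CommRing R] [CommRing S]

instance (r : ℕ) : AddCommGroup (SymPow R r) :=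
  inferInstanceAs (AddCommGroup ↥(homogeneousSubmodule (Fin 2) R r))

instance (r : ℕ) : Module R (SymPow R r) :=
  inferInstanceAs (Module R ↥(homogeneousSubmodule (Fin 2) R r))

namespace SymPow

variable {r : ℕ}

/-- The polynomial underlying an element of `Sym^r R²`. -/
def poly : SymPow R r →ₗ[R] MvPolynomial (Fin 2) R := (homogeneousSubmodule (Fin 2) R r).subtype

lemma poly_injective : Function.Injective (poly : SymPow R r → MvPolynomial (Fin 2) R) :=
  Subtype.val_injective

@[ext] lemma ext {f g : SymPow R r} (h : f.poly = g.poly) : f = g := poly_injective h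

lemma isHomogeneous (f : SymPow R r) : f.poly.IsHomogeneous r := f.2

/-- A homogeneous polynomial of degree `r` as an element of `Sym^r R²`. -/
def mk (f : MvPolynomial (Fin 2) R) (hf : f.IsHomogeneous r) : SymPow R r := ⟨f, hf⟩

@[simp] lemma poly_mk (f : MvPolynomial (Fin 2) R) (hf : f.IsHomogeneous r) :
    (mk f hf).poly = f := rfl

end SymPow

/-- The substitution `f(x, y) ↦ f(a x + c y, b x + d y)` attached to the matrix `(a, b; c, d)`. -/
def subst (M : Matrix (Fin 2) (Fin 2) R) : MvPolynomial (Fin 2) R →ₐ[R] MvPolynomial (Fin 2) R :=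
  aeval fun j => ∑ i, C (M i j) * X i

lemma subst_X (M : Matrix (Fin 2) (Fin 2) R) (j : Fin 2) :
    subst M (X j) = ∑ i, C (M i j) * X i := by
  simp [subst]

lemma subst_one : subst (1 : Matrix (Fin 2) (Fin 2) R) = AlgHom.id R _ := by
  apply MvPolynomial.algHom_ext
  intro j
  rw [subst_X]
  fin_cases j <;> simp [Matrix.one_apply]

lemma subst_mul (M N : Matrix (Fin 2) (Fin 2) R) :
    subst (M * N) = (subst M).comp (subst N) := by
  apply MvPolynomial.algHom_ext
  intro j
  have hC : ∀ a : R, subst M (C a) = C a := fun a => (subst M).commutes a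
  rw [AlgHom.comp_apply, subst_X, subst_X]
  simp only [map_mul, subst_X, hC, Matrix.mul_apply, Fin.sum_univ_two, map_add]
  ring

lemma subst_isHomogeneous (M : Matrix (Fin 2) (Fin 2) R) {f : MvPolynomial (Fin 2) R} {r : ℕ}
    (hf : f.IsHomogeneous r) : (subst M f).IsHomogeneous r := by
  have := hf.aeval (S := R) (n := 1) (fun j => ∑ i, C (M i j) * X i)
    (fun j => IsHomogeneous.sum _ _ _ fun i _ => isHomogeneous_C_mul_X _ _)
  rwa [one_mul] at this

lemma map_subst (σ : R →+* S) (M : Matrix (Fin 2) (Fin 2) R) (f : MvPolynomial (Fin 2) R) :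
    MvPolynomial.map σ (subst M f) = subst (M.map σ) (MvPolynomial.map σ f) := by
  induction f using MvPolynomial.induction_on with
  | C a =>
    have h1 : subst M (C a) = C a := (subst M).commutes a
    have h2 : subst (M.map σ) (C (σ a)) = C (σ a) := (subst (M.map σ)).commutes (σ a)
    rw [h1, MvPolynomial.map_C, h2]
  | add f g hf hg => simp only [map_add, hf, hg]
  | mul_X f j hf => simp only [map_mul, hf, subst_X, map_sum, MvPolynomial.map_X,
      MvPolynomial.map_C, Matrix.map_apply]

/-- The action of `2 × 2` matrices on `Sym^r R²`. -/
def symEnd (r : ℕ) : Matrix (Fin 2) (Fin 2) R →* Module.End R (SymPow R r) where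
  toFun M :=
    { toFun := fun f => SymPow.mk (subst M f.poly) (subst_isHomogeneous M f.isHomogeneous)
      map_add' := fun f g => by ext1; simp
      map_smul' := fun a f => by ext1; simp }
  map_one' := by ext1 f; ext1; simp [subst_one]
  map_mul' M N := by ext1 f; ext1; simp [subst_mul]

@[simp] lemma symEnd_apply (r : ℕ) (M : Matrix (Fin 2) (Fin 2) R) (f : SymPow R r) :
    (symEnd r M f).poly = subst M f.poly := rfl

/-- The action of `K` on `Sym^r R²` for a ring `R` over `ℤ_p`. -/
def symRep {p : ℕ} [Fact p.Prime] (j : ℤ_[p] →+* R) (r : ℕ) : Representation R (K p) (SymPow R r) :=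
  (symEnd r).comp (j.mapMatrix.toMonoidHom.comp (Units.coeHom (Matrix (Fin 2) (Fin 2) ℤ_[p])))

lemma symRep_apply {p : ℕ} [Fact p.Prime] (j : ℤ_[p] →+* R) (r : ℕ) (κ : K p) :
    symRep j r κ = symEnd r (κ.1.map j) := rfl

/-- Change of coefficients `Sym^r R² → Sym^r S²` along `σ : R → S`. -/
def symMap (σ : R →+* S) (r : ℕ) : SymPow R r →ₛₗ[σ] SymPow S r where
  toFun f := SymPow.mk (MvPolynomial.map σ f.poly) (f.isHomogeneous.map σ)
  map_add' f g := by ext1; simp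
  map_smul' a f := by ext1; simp [MvPolynomial.smul_eq_C_mul]

@[simp] lemma symMap_poly (σ : R →+* S) (r : ℕ) (f : SymPow R r) :
    (symMap σ r f).poly = MvPolynomial.map σ f.poly := rfl

lemma symMap_symRep {p : ℕ} [Fact p.Prime] (σ : R →+* S) (j : ℤ_[p] →+* R) (j' : ℤ_[p] →+* S)
    (hj : σ.comp j = j') (r : ℕ) (κ : K p) (f : SymPow R r) :
    symMap σ r (symRep j r κ f) = symRep j' r κ (symMap σ r f) := by
  subst hj
  ext1
  rw [symMap_poly, symRep_apply, symRep_apply, symEnd_apply, symEnd_apply, map_subst]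
  rfl

end SymmetricPowers

/-! ### The Hecke operator -/

section Hecke

variable (p : ℕ) [Fact p.Prime]

/-- The Teichmüller representative `[l] ∈ ℤ_p` of `l ∈ 𝔽_p`. -/
def teich (l : ZMod p) : ℤ_[p] := WittVector.equiv p (WittVector.teichmuller p l)

lemma exists_teich_residue : ∃ e : ZMod p → ZMod p, Function.Bijective e ∧
    ∀ l (a : ℤ_[p]), (∃ q, a - teich p l = p * q) ↔ PadicInt.toZMod a = e l := by
  have hker : ∀ a b : ℤ_[p], (∃ q, a - b = p * q) ↔ PadicInt.toZMod a = PadicInt.toZMod b := by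
    intro a b
    rw [← sub_eq_zero (b := PadicInt.toZMod b), ← map_sub, ← RingHom.mem_ker, PadicInt.ker_toZMod,
      PadicInt.maximalIdeal_eq_span_p, Ideal.mem_span_singleton]
    rfl
  refine ⟨fun l => PadicInt.toZMod (teich p l), ?_, fun l a => hker a _⟩
  apply Finite.injective_iff_bijective.mp
  intro l m h
  obtain ⟨q, hq⟩ := (hker _ _).2 h
  have h2 : WittVector.teichmuller p l - WittVector.teichmuller p m ∈
      Ideal.span {((p : ℕ) : WittVector p (ZMod p))} := by
    rw [Ideal.mem_span_singleton]
    refine ⟨(WittVector.equiv p).symm q, ?_⟩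
    apply (WittVector.equiv p).injective
    simpa [teich] using hq
  rw [← Ideal.Quotient.eq_zero_iff_mem, map_sub, sub_eq_zero, Ideal.Quotient.eq,
    ← WittVector.ker_constantCoeff, RingHom.mem_ker, map_sub, sub_eq_zero] at h2
  simpa [WittVector.constantCoeff] using h2

/-- Representatives of the left cosets of `K` in the set of `2 × 2` matrices over `ℤ_p` whose
determinant has valuation one: `(p, [l]; 0, 1)` for `l ∈ 𝔽_p`, and `(1, 0; 0, p)`. -/
def heckeMat : Option (ZMod p) → Matrix (Fin 2) (Fin 2) ℤ_[p]
  | some l => !![(p : ℤ_[p]), teich p l; 0, 1]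
  | none => !![1, 0; 0, (p : ℤ_[p])]

lemma heckeMat_det (i : Option (ZMod p)) : (heckeMat p i).det = p := by
  cases i <;> simp [heckeMat, Matrix.det_fin_two_of]

lemma heckeMat_det_ne (i : Option (ZMod p)) :
    ((heckeMat p i).map ((↑) : ℤ_[p] → ℚ_[p])).det ≠ 0 := by
  have : ((heckeMat p i).map ((↑) : ℤ_[p] → ℚ_[p])).det = (((heckeMat p i).det : ℤ_[p]) : ℚ_[p]) := by
    exact (RingHom.map_det PadicInt.Coe.ringHom (heckeMat p i)).symm
  rw [this, heckeMat_det]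
  simpa using padic_p_ne_zero p

/-- The same matrices as elements of `G`. -/
def heckeG (i : Option (ZMod p)) : G p :=
  Matrix.GeneralLinearGroup.mkOfDetNeZero _ (heckeMat_det_ne p i)

/-- Every matrix of determinant `p` times a unit is a representative times an element of `K`. -/
lemma exists_heckeMat_mul (A : Matrix (Fin 2) (Fin 2) ℤ_[p]) (u : ℤ_[p]ˣ) (hA : A.det = p * u) :
    ∃ (i : Option (ZMod p)) (κ : K p), A = heckeMat p i * κ.1 := by
  have hp0 : (p : ℤ_[p]) ≠ 0 := by exact_mod_cast (Fact.out : p.Prime).ne_zero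
  suffices h : ∃ (i : Option (ZMod p)) (B : Matrix (Fin 2) (Fin 2) ℤ_[p]), A = heckeMat p i * B by
    obtain ⟨i, B, hB⟩ := h
    have hdet : B.det = u := by
      apply mul_left_cancel₀ hp0
      rw [← hA, hB, Matrix.det_mul, heckeMat_det]
    exact ⟨i, Matrix.GeneralLinearGroup.mk'' B (hdet ▸ u.isUnit), by simpa using hB⟩
  obtain ⟨e, he, hel⟩ := exists_teich_residue p
  have hker : ∀ a : ℤ_[p], PadicInt.toZMod a = 0 ↔ ∃ q, a = p * q := by
    intro a
    rw [← RingHom.mem_ker, PadicInt.ker_toZMod, PadicInt.maximalIdeal_eq_span_p,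
      Ideal.mem_span_singleton]
    rfl
  have hdet0 : PadicInt.toZMod (A 0 0) * PadicInt.toZMod (A 1 1) =
      PadicInt.toZMod (A 0 1) * PadicInt.toZMod (A 1 0) := by
    have : PadicInt.toZMod A.det = 0 := by rw [hA]; simp
    rw [Matrix.det_fin_two, map_sub, map_mul, map_mul, sub_eq_zero] at this
    exact this
  -- the bottom row mod `p` is either zero or spans the row space mod `p`
  by_cases hbot : PadicInt.toZMod (A 1 0) = 0 ∧ PadicInt.toZMod (A 1 1) = 0
  · obtain ⟨q, hq⟩ := (hker _).1 hbot.1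
    obtain ⟨q', hq'⟩ := (hker _).1 hbot.2
    refine ⟨none, !![A 0 0, A 0 1; q, q'], ?_⟩
    ext i j
    fin_cases i <;> fin_cases j <;> simp [heckeMat, Matrix.mul_apply, Fin.sum_univ_two, hq, hq']
  · have hex : ∃ l : ZMod p, PadicInt.toZMod (A 0 0) = l * PadicInt.toZMod (A 1 0) ∧
        PadicInt.toZMod (A 0 1) = l * PadicInt.toZMod (A 1 1) := by
      by_cases h0 : PadicInt.toZMod (A 1 0) = 0
      · have h1 : PadicInt.toZMod (A 1 1) ≠ 0 := fun h => hbot ⟨h0, h⟩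
        refine ⟨PadicInt.toZMod (A 0 1) / PadicInt.toZMod (A 1 1), ?_, by field_simp⟩
        rw [h0, mul_zero] at hdet0 ⊢
        exact (mul_eq_zero.1 hdet0).resolve_right h1
      · refine ⟨PadicInt.toZMod (A 0 0) / PadicInt.toZMod (A 1 0), by field_simp, ?_⟩
        field_simp
        exact hdet0.symm
    obtain ⟨l, h0, h1⟩ := hex
    obtain ⟨m, rfl⟩ := he.2 l
    have ht : PadicInt.toZMod (teich p m) = e m := (hel m _).1 ⟨0, by simp⟩
    obtain ⟨q, hq⟩ := (hker (A 0 0 - teich p m * A 1 0)).1 (by simp [h0, ht])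
    obtain ⟨q', hq'⟩ := (hker (A 0 1 - teich p m * A 1 1)).1 (by simp [h1, ht])
    refine ⟨some m, !![q, q'; A 1 0, A 1 1], ?_⟩
    ext i j
    fin_cases i <;> fin_cases j <;>
      simp [heckeMat, Matrix.mul_apply, Fin.sum_univ_two, ← hq, ← hq']

/-- The representatives lie in distinct cosets. -/
lemma heckeMat_unique {i i' : Option (ZMod p)} {κ : K p}
    (h : heckeMat p i = heckeMat p i' * κ.1) : i = i' := by
  obtain ⟨e, he, hel⟩ := exists_teich_residue p
  have hpu : ∀ q : ℤ_[p], (1 : ℤ_[p]) ≠ p * q := by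
    intro q hq
    have : (PadicInt.toZMod (1 : ℤ_[p])) = PadicInt.toZMod ((p : ℤ_[p]) * q) := by rw [← hq]
    simp at this
  have h00 := congrFun (congrFun h 0) 0
  have h01 := congrFun (congrFun h 0) 1
  have h10 := congrFun (congrFun h 1) 0
  have h11 := congrFun (congrFun h 1) 1
  cases i with
  | none =>
    cases i' with
    | none => rfl
    | some m =>
      simp only [heckeMat, Matrix.mul_apply, Fin.sum_univ_two, Matrix.of_apply, Matrix.cons_val_zero,
        Matrix.cons_val_one, Matrix.cons_val', Matrix.cons_val_fin_one, zero_mul, one_mul,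
        zero_add] at h00 h01 h10 h11
      exact absurd (by rw [h00, ← h10, mul_zero, add_zero]) (hpu (κ.1 0 0))
  | some l =>
    cases i' with
    | none =>
      simp only [heckeMat, Matrix.mul_apply, Fin.sum_univ_two, Matrix.of_apply, Matrix.cons_val_zero,
        Matrix.cons_val_one, Matrix.cons_val', Matrix.cons_val_fin_one, zero_mul, one_mul,
        zero_add] at h00 h01 h10 h11
      exact absurd h11 (hpu _)
    | some m =>
      simp only [heckeMat, Matrix.mul_apply, Fin.sum_univ_two, Matrix.of_apply, Matrix.cons_val_zero,
        Matrix.cons_val_one, Matrix.cons_val', Matrix.cons_val_fin_one, zero_mul, one_mul,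
        zero_add] at h00 h01 h10 h11
      rw [← h11, mul_one] at h01
      have h1 := (hel m (teich p l)).1 ⟨κ.1 0 1, by rw [h01]; ring⟩
      have h2 := (hel l (teich p l)).1 ⟨0, by simp⟩
      rw [he.1 (h2.symm.trans h1)]

/-- Left multiplication by `K` permutes the cosets. -/
lemma exists_perm (κ : K p) : ∃ (e : Equiv.Perm (Option (ZMod p))) (τ : Option (ZMod p) → K p),
    ∀ i, κ.1 * heckeMat p i = heckeMat p (e i) * (τ i).1 := by
  have h : ∀ i, ∃ (i' : Option (ZMod p)) (τ : K p), κ.1 * heckeMat p i = heckeMat p i' * τ.1 := by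
    intro i
    refine exists_heckeMat_mul p _ κ.det ?_
    rw [Matrix.det_mul, heckeMat_det, mul_comm]
    rfl
  choose e τ h using h
  have he : Function.Bijective e := by
    apply Finite.injective_iff_bijective.mp
    intro i i' hii
    have h1 := h i
    have h2 := h i'
    rw [hii] at h1
    have h3 : heckeMat p i = heckeMat p i' * ((τ i')⁻¹ * τ i : K p).1 := by
      have h4 : κ.1 * heckeMat p i = κ.1 * (heckeMat p i' * ((τ i')⁻¹ * τ i : K p).1) := by
        rw [← mul_assoc, h2, h1, Units.val_mul, mul_assoc, ← mul_assoc (τ i').1, Units.mul_inv,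
          one_mul]
      have h5 := congrArg (fun M => (κ⁻¹).1 * M) h4
      simpa only [← mul_assoc, Units.inv_mul, one_mul] using h5
    exact heckeMat_unique p h3
  exact ⟨Equiv.ofBijective e he, τ, h⟩

lemma toG_heckeG_eq {κ τ : K p} {i i' : Option (ZMod p)}
    (h : κ.1 * heckeMat p i = heckeMat p i' * τ.1) :
    toG p κ * heckeG p i = heckeG p i' * toG p τ := by
  apply Units.ext
  have := congrArg (fun M => (PadicInt.Coe.ringHom (p := p)).mapMatrix M) h
  simp only [map_mul] at this
  exact this

/-- Only finitely many right cosets of `K` meet the coset of a representative. -/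
lemma exists_right_reps : ∃ D : Set (G p), D.Finite ∧
    ∀ i (κ : K p), ∃ δ ∈ D, ∃ τ : K p, heckeG p i * toG p κ = toG p τ * δ := by
  have hdetT : ∀ i, ((heckeMat p i)ᵀ.map ((↑) : ℤ_[p] → ℚ_[p])).det ≠ 0 := by
    intro i
    have := heckeMat_det_ne p i
    rwa [← Matrix.det_transpose] at this
  refine ⟨Set.range fun i => Matrix.GeneralLinearGroup.mkOfDetNeZero _ (hdetT i),
    Set.finite_range _, fun i κ => ?_⟩
  obtain ⟨i', τ, h⟩ := exists_heckeMat_mul p (heckeMat p i * κ.1)ᵀ κ.det (by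
    rw [Matrix.det_transpose, Matrix.det_mul, heckeMat_det]
    rfl)
  refine ⟨_, ⟨i', rfl⟩, Matrix.GeneralLinearGroup.mk'' τ.1ᵀ (by
    rw [Matrix.det_transpose]
    exact τ.det.isUnit), ?_⟩
  apply Units.ext
  have h' := congrArg Matrix.transpose h
  rw [Matrix.transpose_transpose, Matrix.transpose_mul] at h'
  have := congrArg (fun M => (PadicInt.Coe.ringHom (p := p)).mapMatrix M) h'
  simp only [map_mul] at this
  exact this

variable {p} {R : Type*} [CommRing R] (j : ℤ_[p] →+* R) (r : ℕ)

/-- The Hecke operator `T` on `ind_{KZ}^G Sym^r R²`, given by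
`(T f)(g) = ∑_δ δ · f(δ⁻¹ g)` with `δ` running over `(p, [l]; 0, 1)`, `l ∈ 𝔽_p`, and `(1, 0; 0, p)`.
Equivalently `T [g, v] = ∑_l [g (p, [l]; 0, 1), v(x, - [l] x + p y)] + [g (1, 0; 0, p), v(p x, y)]`.
-/
def heckeT : ind (symRep j r) →ₗ[R] ind (symRep j r) where
  toFun f := ⟨fun g => ∑ i : Option (ZMod p), symEnd r ((heckeMat p i).map j)
      (f.1 ((heckeG p i)⁻¹ * g)), by
    refine ⟨fun κ g => ?_, fun g => ?_, ?_⟩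
    · obtain ⟨e, τ, h⟩ := exists_perm p κ
      rw [map_sum]
      refine (Fintype.sum_equiv e _ _ fun i => ?_).symm
      have hG := toG_heckeG_eq p (h i)
      have hg : (heckeG p (e i))⁻¹ * (toG p κ * g) = toG p (τ i) * ((heckeG p i)⁻¹ * g) := by
        rw [← mul_assoc, ← mul_assoc]
        congr 1
        rw [inv_mul_eq_iff_eq_mul, ← mul_assoc, ← hG, mul_inv_cancel_right]
      rw [hg, ind_toG, symRep_apply, symRep_apply, ← Module.End.mul_apply, ← Module.End.mul_apply,
        ← map_mul, ← map_mul]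
      have hM := congrArg (fun M => j.mapMatrix M) (h i)
      simp only [map_mul, RingHom.mapMatrix_apply] at hM
      rw [hM]
    · refine Finset.sum_congr rfl fun i _ => ?_
      rw [← mul_assoc, ← pZ_comm, mul_assoc, ind_pZ]
    · obtain ⟨D, hD, hDr⟩ := exists_right_reps p
      obtain ⟨S, hS, hf⟩ := f.2.2.2
      refine ⟨Set.image2 (fun δ s => δ * s) D S, hD.image2 _ hS, fun g hg => ?_⟩
      obtain ⟨i, -, hi⟩ := Finset.exists_ne_zero_of_sum_ne_zero hg
      have hi' : f.1 ((heckeG p i)⁻¹ * g) ≠ 0 := fun h => hi (by rw [h, map_zero])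
      obtain ⟨s, hs, κ, n, hκ⟩ := hf _ hi'
      obtain ⟨δ, hδ, τ, hτ⟩ := hDr i κ
      refine ⟨_, ⟨δ, hδ, s, hs, rfl⟩, τ, n, ?_⟩
      rw [inv_mul_eq_iff_eq_mul] at hκ
      calc g = heckeG p i * toG p κ * (pZ p ^ n * s) := by rw [hκ]; simp only [mul_assoc]
        _ = toG p τ * (δ * pZ p ^ n) * s := by rw [hτ]; simp only [mul_assoc]
        _ = _ := by rw [← pZ_zpow_comm]; simp only [mul_assoc]⟩
  map_add' f f' := by
    ext1
    funext g
    simp [Finset.sum_add_distrib]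
  map_smul' a f := by
    ext1
    funext g
    simp [Finset.smul_sum]

lemma heckeT_apply (f : ind (symRep j r)) (g : G p) : (heckeT j r f).1 g =
    ∑ i : Option (ZMod p), symEnd r ((heckeMat p i).map j) (f.1 ((heckeG p i)⁻¹ * g)) := rfl

lemma heckeT_comm (f : ind (symRep j r)) (g : G p) :
    heckeT j r (indRep _ g f) = indRep _ g (heckeT j r f) := by
  ext1
  funext x
  simp only [heckeT_apply, indRep_apply, mul_assoc]

end Hecke

/-! ### The lattice `Θ`, its reduction, and the map `P` -/

section Theta

variable (p : ℕ) [Fact p.Prime]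

/-- `ℚ̄_p`. -/
abbrev Qbar : Type := PadicAlgCl p

/-- `ℤ̄_p`, the ring of integers of `ℚ̄_p`. -/
abbrev Zbar : Type := ↥𝒪[PadicAlgCl p]

/-- `𝔽̄_p`, the residue field of `ℤ̄_p`. -/
def Fbar : Type := 𝓀[PadicAlgCl p]

instance : Field (Fbar p) := inferInstanceAs (Field 𝓀[PadicAlgCl p])

/-- The reduction map `ℤ̄_p → 𝔽̄_p`. -/
def toRes : Zbar p →+* Fbar p := IsLocalRing.residue (Zbar p)

instance : Algebra (Zbar p) (Fbar p) := (toRes p).toAlgebra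

lemma toRes_surjective : Function.Surjective (toRes p) :=
  IsLocalRing.residue_surjective (R := Zbar p)

/-- The valuation `ν` of `ℚ̄_p`, normalised by `ν(p) = 1` (used at nonzero arguments only). -/
def nu (a : Qbar p) : ℝ := -Real.logb p ‖a‖

/-- `ℤ_p → ℚ̄_p`. -/
def toQbar : ℤ_[p] →+* Qbar p := (algebraMap ℚ_[p] (PadicAlgCl p)).comp PadicInt.Coe.ringHom

/-- `ℤ_p → ℤ̄_p`. -/
def toZbar : ℤ_[p] →+* Zbar p :=
  (toQbar p).codRestrict 𝒪[PadicAlgCl p] fun x => by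
    change Valued.v (toQbar p x) ≤ 1
    rw [PadicAlgCl.valuation_def, ← NNReal.coe_le_coe, coe_nnnorm]
    have := PadicAlgCl.norm_extends p (x : ℚ_[p])
    exact this.trans_le (PadicInt.norm_le_one x)

/-- `ℤ_p → 𝔽̄_p`. -/
def toFbar : ℤ_[p] →+* Fbar p := (toRes p).comp (toZbar p)

variable (r : ℕ) (a : Qbar p)

/-- The compact induction of `Sym^r ℚ̄_p²`. -/
abbrev IndQ : Type := ↥(ind (symRep (toQbar p) r))

/-- The compact induction of `Sym^r ℤ̄_p²`. -/
abbrev IndZ : Type := ↥(ind (symRep (toZbar p) r))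

/-- The compact induction of `V_r = Sym^r 𝔽̄_p²`. -/
abbrev IndF : Type := ↥(ind (symRep (toFbar p) r))

/-- `(T - a_p) ind Sym^r ℚ̄_p²`. -/
def heckeRange : Submodule (Qbar p) (IndQ p r) :=
  LinearMap.range (heckeT (toQbar p) r - a • (LinearMap.id : IndQ p r →ₗ[Qbar p] IndQ p r))

lemma heckeRange_le (g : G p) :
    heckeRange p r a ≤ (heckeRange p r a).comap (indRep (symRep (toQbar p) r) g) := by
  rintro _ ⟨f, rfl⟩
  refine ⟨indRep _ g f, ?_⟩
  simp [heckeT_comm]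

/-- `Π_{k, a_p} = ind Sym^r ℚ̄_p² / (T - a_p)` with `k = r + 2`. -/
abbrev PiRep : Type := IndQ p r ⧸ heckeRange p r a

/-- The action of `G` on `Π_{k, a_p}`. -/
def piAction : Representation (Qbar p) (G p) (PiRep p r a) :=
  (indRep (symRep (toQbar p) r)).quotient (heckeRange p r a) (heckeRange_le p r a)

/-- The map `ind Sym^r ℤ̄_p² → Π_{k, a_p}`. -/
def indZToPi : IndZ p r →ₗ[Zbar p] PiRep p r a where
  toFun f := (heckeRange p r a).mkQ (indMap (ρ := symRep (toZbar p) r) (ρ' := symRep (toQbar p) r)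
    (symMap (algebraMap (Zbar p) (Qbar p)) r) (symMap_symRep _ _ _ rfl r) f)
  map_add' f g := by rw [map_add, map_add]
  map_smul' c f := by
    rw [LinearMap.map_smulₛₗ, LinearMap.map_smul]
    rfl

lemma indZToPi_indRep (g : G p) (f : IndZ p r) :
    indZToPi p r a (indRep _ g f) = piAction p r a g (indZToPi p r a f) := rfl

/-- The lattice `Θ_{k, a_p}`, the image of `ind Sym^r ℤ̄_p²` in `Π_{k, a_p}`, where `k = r + 2`. -/
def Theta : Submodule (Zbar p) (PiRep p r a) := LinearMap.range (indZToPi p r a)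

/-- The surjection `ind Sym^r ℤ̄_p² → Θ_{k, a_p}`. -/
def indZToTheta : IndZ p r →ₗ[Zbar p] ↥(Theta p r a) := (indZToPi p r a).rangeRestrict

/-- The action of `G` on `Θ_{k, a_p}`. -/
def thetaAction : Representation (Zbar p) (G p) ↥(Theta p r a) where
  toFun g := ((piAction p r a g).restrictScalars (Zbar p)).restrict (by
    rintro _ ⟨f, rfl⟩
    exact ⟨indRep _ g f, indZToPi_indRep p r a g f⟩)
  map_one' := by
    ext1 x
    apply Subtype.ext
    change piAction p r a 1 x.1 = x.1
    simp
  map_mul' g h := by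
    ext1 x
    apply Subtype.ext
    change piAction p r a (g * h) x.1 = piAction p r a g (piAction p r a h x.1)
    simp

/-- `Θ̄_{k, a_p} = 𝔽̄_p ⊗ Θ_{k, a_p}`, where `k = r + 2`. -/
abbrev ThetaBar : Type := Fbar p ⊗[Zbar p] ↥(Theta p r a)

/-- The action of `G` on `Θ̄_{k, a_p}`. -/
def thetaBarAction : Representation (Fbar p) (G p) (ThetaBar p r a) where
  toFun g := (thetaAction p r a g).baseChange (Fbar p)
  map_one' := by
    rw [map_one]
    exact LinearMap.baseChange_id
  map_mul' g h := by
    rw [map_mul]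
    exact LinearMap.baseChange_comp ..

/-- Reduction of coefficients `ind Sym^r ℤ̄_p² → ind V_r`. -/
def reduction : IndZ p r →ₛₗ[toRes p] IndF p r :=
  indMap (ρ := symRep (toZbar p) r) (ρ' := symRep (toFbar p) r)
    (symMap (toRes p) r) (symMap_symRep _ _ _ rfl r)

lemma symMap_residue_surjective :
    Function.Surjective (symMap (toRes p) r) := by
  intro f
  obtain ⟨F, hF⟩ := MvPolynomial.map_surjective _ (toRes_surjective p) f.poly
  refine ⟨SymPow.mk _ (homogeneousComponent_isHomogeneous r F), SymPow.ext ?_⟩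
  have hf : homogeneousComponent r f.poly = f.poly := by
    rw [homogeneousComponent_of_mem f.isHomogeneous, if_pos rfl]
  rw [symMap_poly, SymPow.poly_mk, ← hf, ← hF]
  ext d
  simp only [coeff_map, coeff_homogeneousComponent]
  split <;> simp

lemma reduction_bracket (g : G p) (v : SymPow (Zbar p) r) :
    reduction p r (bracket _ g v) =
      bracket _ g (symMap (toRes p) r v) := by
  ext1
  funext x
  change symMap (toRes p) r (bracketFun _ g v x) = bracketFun _ g _ x
  by_cases h : InCoset x g⁻¹
  · obtain ⟨κ, n, rfl⟩ := h
    rw [bracketFun_kz, bracketFun_kz, symMap_symRep _ _ _ rfl]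
    rfl
  · rw [bracketFun_of_not _ _ _ h, bracketFun_of_not _ _ _ h, map_zero]

lemma reduction_surjective : Function.Surjective (reduction p r) := by
  intro f
  refine ind_induction (fun _ => True) (M := fun f => ∃ F, reduction p r F = f)
    ⟨0, map_zero _⟩ ?_ f (fun _ => trivial) trivial
  rintro _ g v - ⟨F, rfl⟩
  obtain ⟨w, rfl⟩ := symMap_residue_surjective p r v
  exact ⟨F + bracket _ g w, by rw [map_add, reduction_bracket]⟩

/-- `f ↦ 1 ⊗ [f]`. -/
def indZToThetaBar : IndZ p r →ₗ[Zbar p] ThetaBar p r a :=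
  (TensorProduct.mk (Zbar p) (Fbar p) ↥(Theta p r a) 1).comp (indZToTheta p r a)

lemma indZToThetaBar_smul (c : Zbar p) (f : IndZ p r) :
    indZToThetaBar p r a (c • f) = toRes p c • indZToThetaBar p r a f := by
  rw [map_smul]
  exact (algebraMap_smul (Fbar p) c _).symm

lemma indZToThetaBar_eq_zero (f : IndZ p r) (hf : reduction p r f = 0) :
    indZToThetaBar p r a f = 0 := by
  refine ind_induction (fun v => symMap (toRes p) r v = 0)
    (M := fun f => indZToThetaBar p r a f = 0) (map_zero _) ?_ f
    (fun g => congrFun (congrArg Subtype.val hf) g) (map_zero _)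
  intro f g v hv hf'
  rw [map_add, hf', zero_add]
  have hv' : ∀ d, toRes p (coeff d v.poly) = 0 := by
    intro d
    have := congrArg (fun w => coeff d w.poly) hv
    rw [← coeff_map]
    exact this
  have hmon : ∀ d ∈ v.poly.support, (monomial d (1 : Zbar p)).IsHomogeneous r := by
    intro d hd
    refine isHomogeneous_monomial _ ?_
    by_contra hne
    exact (mem_support_iff.1 hd) (IsHomogeneous.coeff_eq_zero v.isHomogeneous hne)
  have hsum : v = ∑ d : v.poly.support, coeff d.1 v.poly •
      SymPow.mk (monomial d.1 (1 : Zbar p)) (hmon d.1 d.2) := by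
    ext1
    rw [map_sum]
    conv_lhs => rw [v.poly.as_sum]
    rw [← Finset.sum_coe_sort]
    refine Finset.sum_congr rfl fun d _ => ?_
    simp [smul_monomial]
  rw [hsum, map_sum, map_sum]
  refine Finset.sum_eq_zero fun d _ => ?_
  rw [map_smul, indZToThetaBar_smul, hv', zero_smul]

lemma indZToThetaBar_congr {f f' : IndZ p r} (h : reduction p r f = reduction p r f') :
    indZToThetaBar p r a f = indZToThetaBar p r a f' := by
  rw [← sub_eq_zero, ← map_sub]
  exact indZToThetaBar_eq_zero p r a _ (by rw [map_sub, h, sub_self])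

/-- The natural map `P : ind V_r → Θ̄_{r + 2, a_p}`, sending the reduction of `f` to `1 ⊗ [f]`. -/
def mapP : IndF p r →ₗ[Fbar p] ThetaBar p r a where
  toFun f := indZToThetaBar p r a (Function.surjInv (reduction_surjective p r) f)
  map_add' f f' := by
    rw [← map_add]
    apply indZToThetaBar_congr
    simp [Function.surjInv_eq]
  map_smul' c f := by
    obtain ⟨c, rfl⟩ := toRes_surjective p c
    rw [RingHom.id_apply, ← indZToThetaBar_smul]
    apply indZToThetaBar_congr
    rw [LinearMap.map_smulₛₗ]
    simp [Function.surjInv_eq]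

lemma mapP_reduction (f : IndZ p r) :
    mapP p r a (reduction p r f) = (1 : Fbar p) ⊗ₜ[Zbar p] indZToTheta p r a f :=
  indZToThetaBar_congr p r a (Function.surjInv_eq (reduction_surjective p r) _)

end Theta

/-! ### The filtration by powers of the Dickson polynomial -/

section Filtration

variable (p : ℕ) [Fact p.Prime]

/-- The Dickson polynomial `θ = x^p y - x y^p`. -/
def dickson : MvPolynomial (Fin 2) (Fbar p) := X 0 ^ p * X 1 - X 0 * X 1 ^ p

/-- `V_r^{(m)} = {f ∈ V_r : θ^m ∣ f}`. -/
def fil (r m : ℕ) : Submodule (Fbar p) (SymPow (Fbar p) r) where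
  carrier := {f | dickson p ^ m ∣ f.poly}
  add_mem' {f g} hf hg := by
    change dickson p ^ m ∣ (f + g).poly
    rw [map_add]
    exact dvd_add hf hg
  zero_mem' := by
    change dickson p ^ m ∣ (0 : SymPow (Fbar p) r).poly
    rw [map_zero]
    exact dvd_zero _
  smul_mem' c f hf := by
    change dickson p ^ m ∣ (c • f).poly
    rw [map_smul, smul_eq_C_mul]
    exact hf.mul_left _

lemma toRes_eq_zero_iff (x : Zbar p) : toRes p x = 0 ↔ x ∈ IsLocalRing.maximalIdeal (Zbar p) :=
  IsLocalRing.residue_eq_zero_iff x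

lemma toFbar_p : toFbar p p = 0 := by
  rw [map_natCast, ← map_natCast (toRes p), toRes_eq_zero_iff, IsLocalRing.mem_maximalIdeal, mem_nonunits_iff]
  rintro ⟨u, hu⟩
  have h1 : (((u⁻¹ : (Zbar p)ˣ) : Zbar p) : Qbar p) * (p : Qbar p) = 1 := by
    have := congrArg (Subtype.val) (u.inv_mul)
    rw [hu] at this
    simpa using this
  have h2 : Valued.v (((u⁻¹ : (Zbar p)ˣ) : Zbar p) : Qbar p) ≤ 1 := ((u⁻¹ : (Zbar p)ˣ) : Zbar p).2
  have h3 := congrArg (fun x => Valued.v x) h1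
  simp only [map_mul, map_one, PadicAlgCl.valuation_p] at h3
  have hp1 : (1 / (p : NNReal)) < 1 := by
    rw [one_div]
    exact inv_lt_one_of_one_lt₀ (by exact_mod_cast (Fact.out : p.Prime).one_lt)
  have := mul_lt_one_of_nonneg_of_lt_one_right h2 zero_le hp1
  exact this.ne h3

instance : CharP (Fbar p) p :=
  (CharP.charP_iff_prime_eq_zero Fact.out).2 (by simpa using toFbar_p p)

lemma toFbar_pow (x : ℤ_[p]) : toFbar p x ^ p = toFbar p x := by
  have h : PadicInt.toZMod (x ^ p - x) = 0 := by
    rw [map_sub, map_pow, ZMod.pow_card, sub_self]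
  rw [← RingHom.mem_ker, PadicInt.ker_toZMod, PadicInt.maximalIdeal_eq_span_p,
    Ideal.mem_span_singleton] at h
  obtain ⟨q, hq⟩ := h
  have := congrArg (toFbar p) hq
  rw [map_mul, toFbar_p, zero_mul, map_sub, map_pow, sub_eq_zero] at this
  exact this

/-- `GL₂(𝔽_p)` acts on `θ` by the determinant. -/
lemma subst_dickson (κ : K p) : subst (κ.1.map (toFbar p)) (dickson p) =
    C (toFbar p κ.1.det) * dickson p := by
  have hC : ∀ i j, (C (toFbar p (κ.1 i j)) : MvPolynomial (Fin 2) (Fbar p)) ^ p =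
      C (toFbar p (κ.1 i j)) := fun i j => by rw [← C_pow, toFbar_pow]
  simp only [dickson, map_sub, map_mul, map_pow, subst_X, Fin.sum_univ_two, Matrix.map_apply,
    add_pow_char, mul_pow, hC, Matrix.det_fin_two]
  ring

lemma fil_le (r m : ℕ) (κ : K p) :
    fil p r m ≤ (fil p r m).comap (symRep (toFbar p) r κ) := by
  intro f hf
  obtain ⟨q, hq⟩ := hf
  refine ⟨C (toFbar p κ.1.det) ^ m * subst (κ.1.map (toFbar p)) q, ?_⟩
  rw [symRep_apply, symEnd_apply, hq, map_mul, map_pow, subst_dickson]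
  ring

/-- `V_r^{(m)}` as a representation of `K`. -/
def filRep (r m : ℕ) : Representation (Fbar p) (K p) ↥(fil p r m) :=
  (symRep (toFbar p) r).subrepresentation (fil p r m) (fil_le p r m)

/-- The quotient `V_r^{(m)} / V_r^{(n)}` (for `m ≤ n`). -/
abbrev Subquot (r m n : ℕ) : Type := ↥(fil p r m) ⧸ (fil p r n).submoduleOf (fil p r m)

/-- `V_r^{(m)} / V_r^{(n)}` as a representation of `K`. -/
def subquotRep (r m n : ℕ) : Representation (Fbar p) (K p) (Subquot p r m n) :=
  (filRep p r m).quotient ((fil p r n).submoduleOf (fil p r m)) fun κ _ hf => fil_le p r n κ hf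

/-- The inclusion `ind V_r^{(m)} → ind V_r`. -/
def indFilIncl (r m : ℕ) : ↥(ind (filRep p r m)) →ₗ[Fbar p] IndF p r :=
  indMap (ρ := filRep p r m) (ρ' := symRep (toFbar p) r) (fil p r m).subtype fun _ _ => rfl

/-- The projection `ind V_r^{(m)} → ind (V_r^{(m)} / V_r^{(n)})`. -/
def indFilProj (r m n : ℕ) : ↥(ind (filRep p r m)) →ₗ[Fbar p] ↥(ind (subquotRep p r m n)) :=
  indMap (ρ := filRep p r m) (ρ' := subquotRep p r m n)
    ((fil p r n).submoduleOf (fil p r m)).mkQ fun _ _ => rfl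

end Filtration

/-- The integer `ε`, equal to `0` if `2c - 1 ≤ b ≤ p`, to `1` if `2(c - 1) - p ≤ b ≤ 2(c - 1)` and
to `2` if `2 ≤ b ≤ 2(c - 1) - (p + 1)`. -/
def eps (p b c : ℕ) : ℕ :=
  if 2 * (c : ℤ) - 1 ≤ b then 0 else if 2 * ((c : ℤ) - 1) - p ≤ b then 1 else 2

end LocalConstancy

end

open LocalConstancy

/-! Call `u`, possibly with denominators, negligible (`negl`) if modulo the image of `T - a` the
function `[1, u]` becomes integral with zero reduction. The negligible `u` form a `K`-stable module
over `ℤ̄_p`, and `P` kills `[g, ū]` for every integral negligible `u`. There are two sources of such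
`u`. Since `[1, u]` is congruent to `a⁻¹ T [1, u]`, it suffices that the transposed Hecke matrices
send `u` into `a` times small polynomials (`mem_negl_of_heckeMat`). Expanding `(T - a) [δ, v]` with
`δ = (1, 0; 0, p)` shows that `δ v` is negligible if `a v` is small and the other transposed Hecke
matrices make `v` small (`symEnd_heckeMat_none_mem_negl`).

Every Hecke substitution makes `θ` divisible by `p`, so `θ^n q` is negligible for `n > ν(a)`; hence
`P` factors through the quotient. For surjectivity it remains to write `V_r` as `V_r^{(c - ε)}` plus
polynomials killed by `P`. Let `E = dicksonInv` and `N = p^(t - 1) d`, so that `E^N` has degree `r -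
s`. Since `E` and `θ` are coprime, a dimension count gives `V_r = E^N V_s + V_r^{(m)}` once `m (p +
1) ≤ s + 1`, and `m = c - ε` satisfies this. So everything rests on `incl_shiftSym_mem_negl`: all of
`E^N Sym^s` is negligible.

For `j ≤ c` the second source makes `p^(j - c) x^(r - j) y^j` negligible, because `ν(a) > c`. The
first source allows `x^(r - s)` to be replaced by `E^N`. As `E` is invariant under `GL₂(𝔽_p)`, `E^N`
is `K`-invariant modulo `p^t`, so `K` may be taken to act on the factor in `Sym^s` alone. Unipotent
translates, projected to a character of the torus, give `p^(j - c) ∑ (s - j choose e - j) E^N x^(s -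
e) y^e` over the `e` in one class modulo `p - 1`. Because `(s)_j (s - j choose e - j) = (s choose e)
(e)_j`, it follows that `p^(n - c) ∑ (s choose e) f(e) E^N x^(s - e) y^e` is negligible for every
integral `f` of degree at most `n ≤ c`. A class contains at most `c + 2` exponents, and an `f`
vanishing at the unwanted ones isolates a single monomial (`forall_mem_of_interpolation`). -/

noncomputable section

namespace LocalConstancy

/-! ### Negligible polynomials and the kernel of `P` -/

section Negligible

variable (p : ℕ) [Fact p.Prime] (r : ℕ) (a : Qbar p)

/-- The inclusion `Sym^r ℤ̄_p² → Sym^r ℚ̄_p²`. -/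
def incl : SymPow (Zbar p) r →ₛₗ[algebraMap (Zbar p) (Qbar p)] SymPow (Qbar p) r :=
  symMap (algebraMap (Zbar p) (Qbar p)) r

lemma incl_injective : Function.Injective (incl p r) := by
  intro f g h
  have h' := congrArg SymPow.poly h
  exact SymPow.ext (MvPolynomial.map_injective _ Subtype.val_injective h')

lemma algebraMap_smul_sym (z : Zbar p) (f : SymPow (Qbar p) r) :
    z • f = algebraMap (Zbar p) (Qbar p) z • f := rfl

/-- The polynomials all of whose coefficients lie in the maximal ideal of `ℤ̄_p`. -/
def smallSym : Submodule (Zbar p) (SymPow (Qbar p) r) where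
  carrier := {f | ∃ F : SymPow (Zbar p) r, incl p r F = f ∧ symMap (toRes p) r F = 0}
  add_mem' := by
    rintro _ _ ⟨F, rfl, hF⟩ ⟨F', rfl, hF'⟩
    exact ⟨F + F', map_add _ _ _, by rw [map_add, hF, hF', add_zero]⟩
  zero_mem' := ⟨0, map_zero _, map_zero _⟩
  smul_mem' := by
    rintro z _ ⟨F, rfl, hF⟩
    exact ⟨z • F, by rw [LinearMap.map_smulₛₗ, algebraMap_smul_sym],
      by rw [LinearMap.map_smulₛₗ, hF, smul_zero]⟩

variable {p r}

lemma symMap_symEnd {R S : Type*} [CommRing R] [CommRing S] (σ : R →+* S)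
    (M : Matrix (Fin 2) (Fin 2) R) (f : SymPow R r) :
    symMap σ r (symEnd r M f) = symEnd r (M.map σ) (symMap σ r f) := by
  ext1
  rw [symMap_poly, symEnd_apply, symEnd_apply, map_subst]
  rfl

lemma smallSym_symEnd (M : Matrix (Fin 2) (Fin 2) ℤ_[p]) {f : SymPow (Qbar p) r}
    (hf : f ∈ smallSym p r) : symEnd r (M.map (toQbar p)) f ∈ smallSym p r := by
  obtain ⟨F, rfl, hF⟩ := hf
  refine ⟨symEnd r (M.map (toZbar p)) F, ?_, ?_⟩
  · rw [incl, symMap_symEnd, Matrix.map_map]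
    rfl
  · rw [symMap_symEnd, hF, map_zero]

lemma smallSym_symRep (κ : K p) {f : SymPow (Qbar p) r}
    (hf : f ∈ smallSym p r) : symRep (toQbar p) r κ f ∈ smallSym p r :=
  smallSym_symEnd κ.1 hf

/-- Integral lifts of the values are unique because `incl` is injective, so equivariance and
finiteness of the support are inherited from `f`. -/
lemma exists_indZ_of_forall_mem_smallSym (f : IndQ p r) (hf : ∀ g, f.1 g ∈ smallSym p r) :
    ∃ F : IndZ p r, reduction p r F = 0 ∧
      indMap (ρ := symRep (toZbar p) r) (ρ' := symRep (toQbar p) r)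
        (symMap (algebraMap (Zbar p) (Qbar p)) r) (symMap_symRep _ _ _ rfl r) F = f := by
  choose F hF hF0 using hf
  refine ⟨⟨F, fun κ g => ?_, fun g => ?_, ?_⟩, ?_, ?_⟩
  · apply incl_injective
    have h := symMap_symRep (algebraMap (Zbar p) (Qbar p)) (toZbar p) (toQbar p) rfl r κ (F g)
    rw [hF, ind_toG, ← hF g]
    exact h.symm
  · apply incl_injective
    rw [hF, hF, ind_pZ]
  · obtain ⟨S, hS, h⟩ := f.2.2.2
    exact ⟨S, hS, fun g hg => h g fun h0 => hg (incl_injective p r (by rw [hF, h0, map_zero]))⟩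
  · ext1
    funext g
    exact hF0 g
  · ext1
    funext g
    exact hF g

/-- The difference of `f` and `(T - a) F` lifts to an integral `F'` of zero reduction. Then `f - F'`
has the same reduction as `f` and lies in the image of `T - a`. -/
lemma mapP_reduction_eq_zero (f : IndZ p r) (F : IndQ p r)
    (h : ∀ g, incl p r (f.1 g) - (heckeT (toQbar p) r F - a • F).1 g ∈ smallSym p r) :
    mapP p r a (reduction p r f) = 0 := by
  let fQ : IndQ p r := indMap (ρ := symRep (toZbar p) r) (ρ' := symRep (toQbar p) r)
        (symMap (algebraMap (Zbar p) (Qbar p)) r) (symMap_symRep _ _ _ rfl r) f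
  obtain ⟨F', hF', hF'Q⟩ := exists_indZ_of_forall_mem_smallSym
    (fQ - (heckeT (toQbar p) r F - a • F)) h
  have h1 : reduction p r f = reduction p r (f - F') := by rw [map_sub, hF', sub_zero]
  have h2 : indZToTheta p r a (f - F') = 0 := by
    apply Subtype.ext
    change (heckeRange p r a).mkQ (indMap (ρ := symRep (toZbar p) r) (ρ' := symRep (toQbar p) r)
        (symMap (algebraMap (Zbar p) (Qbar p)) r) (symMap_symRep _ _ _ rfl r) (f - F')) = 0
    rw [map_sub, hF'Q, sub_sub_cancel, Submodule.mkQ_apply, Submodule.Quotient.mk_eq_zero]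
    exact ⟨F, rfl⟩
  rw [h1, mapP_reduction, h2, TensorProduct.tmul_zero]

lemma mapP_indRep (g : G p) (f : IndF p r) :
    mapP p r a (indRep _ g f) = thetaBarAction p r a g (mapP p r a f) := by
  obtain ⟨f, rfl⟩ := reduction_surjective p r f
  have h : indRep _ g (reduction p r f) = reduction p r (indRep _ g f) := rfl
  rw [h, mapP_reduction, mapP_reduction]
  rfl

lemma mapP_surjective : Function.Surjective (mapP p r a) := by
  intro x
  induction x using TensorProduct.induction_on with
  | zero => exact ⟨0, map_zero _⟩
  | tmul c y =>
    obtain ⟨_, f, rfl⟩ := y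
    refine ⟨c • reduction p r f, ?_⟩
    rw [map_smul, mapP_reduction, TensorProduct.smul_tmul', smul_eq_mul, mul_one]
    rfl
  | add x y hx hy =>
    obtain ⟨f, rfl⟩ := hx
    obtain ⟨f', rfl⟩ := hy
    exact ⟨f + f', map_add _ _ _⟩

lemma bracket_eq_indRep {k W : Type*} [CommRing k] [AddCommGroup W] [Module k W]
    (ρ : Representation k (K p) W) (g : G p) (v : W) :
    bracket ρ g v = indRep ρ g (bracket ρ 1 v) := by
  ext1
  funext x
  change bracketFun ρ g v x = bracketFun ρ 1 v (x * g)
  by_cases h : InCoset x g⁻¹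
  · obtain ⟨κ, n, rfl⟩ := h
    have := bracketFun_kz ρ 1 v κ n
    rw [inv_one, mul_one] at this
    rw [bracketFun_kz, inv_mul_cancel_right, this]
  · rw [bracketFun_of_not _ _ _ h, bracketFun_of_not]
    intro h'
    apply h
    simpa using h'.mul_right g⁻¹

lemma ind_smul_apply {k W : Type*} [CommRing k] [AddCommGroup W] [Module k W]
    {ρ : Representation k (K p) W} (c : k) (f : ind ρ) (g : G p) : (c • f).1 g = c • f.1 g := rfl

lemma ind_add_apply {k W : Type*} [CommRing k] [AddCommGroup W] [Module k W]
    {ρ : Representation k (K p) W} (f f' : ind ρ) (g : G p) : (f + f').1 g = f.1 g + f'.1 g := rfl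

variable (p r) in
/-- The polynomials `u` for which `[1, u]` is, modulo the range of `T - a`, an element of
`ind Sym^r ℤ̄_p²` with coefficients in the maximal ideal. -/
def negl : Submodule (Zbar p) (SymPow (Qbar p) r) where
  carrier := {u | ∃ F : IndQ p r, ∀ g, (bracket (symRep (toQbar p) r) 1 u).1 g -
    ((heckeT (toQbar p) r F).1 g - a • F.1 g) ∈ smallSym p r}
  add_mem' := by
    rintro u u' ⟨F, hF⟩ ⟨F', hF'⟩
    refine ⟨F + F', fun g => ?_⟩
    have := add_mem (hF g) (hF' g)
    rw [map_add, map_add, ind_add_apply, ind_add_apply, ind_add_apply, smul_add, add_sub_add_comm,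
      add_sub_add_comm]
    exact this
  zero_mem' := ⟨0, fun g => by simp⟩
  smul_mem' := by
    rintro z u ⟨F, hF⟩
    refine ⟨algebraMap (Zbar p) (Qbar p) z • F, fun g => ?_⟩
    have := (smallSym p r).smul_mem z (hF g)
    rw [algebraMap_smul_sym] at this ⊢
    rw [map_smul, map_smul, ind_smul_apply, ind_smul_apply, ind_smul_apply, smul_comm a, ← smul_sub,
      ← smul_sub]
    exact this

variable {a}

lemma mapP_bracket_eq_zero {f : SymPow (Zbar p) r} (hf : incl p r f ∈ negl p r a) (g : G p) :
    mapP p r a (bracket _ g (symMap (toRes p) r f)) = 0 := by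
  obtain ⟨F, hF⟩ := hf
  rw [bracket_eq_indRep, mapP_indRep, ← reduction_bracket, mapP_reduction_eq_zero a _ F, map_zero]
  intro x
  convert hF x using 1
  change incl p r (bracketFun _ 1 f x) - _ = bracketFun _ 1 _ x - _
  congr 1
  by_cases h : InCoset x 1⁻¹
  · obtain ⟨κ, n, rfl⟩ := h
    rw [bracketFun_kz, bracketFun_kz]
    exact symMap_symRep _ _ _ rfl r κ f
  · rw [bracketFun_of_not _ _ _ h, bracketFun_of_not _ _ _ h, map_zero]

lemma smallSym_le_negl : smallSym p r ≤ negl p r a := by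
  intro u hu
  refine ⟨0, fun g => ?_⟩
  have h0 : (0 : IndQ p r).1 g = 0 := rfl
  rw [map_zero, h0, smul_zero, sub_zero, sub_zero]
  change bracketFun _ 1 u g ∈ _
  by_cases h : InCoset g 1⁻¹
  · obtain ⟨κ, n, rfl⟩ := h
    rw [bracketFun_kz]
    exact smallSym_symRep κ hu
  · rw [bracketFun_of_not _ _ _ h]
    exact zero_mem _

lemma bracket_one_symRep {k W : Type*} [CommRing k] [AddCommGroup W] [Module k W]
    (ρ : Representation k (K p) W) (κ : K p) (v : W) :
    bracket ρ 1 (ρ κ v) = indRep ρ (toG p κ) (bracket ρ 1 v) := by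
  ext1
  funext x
  change bracketFun ρ 1 (ρ κ v) x = bracketFun ρ 1 v (x * toG p κ)
  by_cases h : InCoset x 1⁻¹
  · obtain ⟨κ', n, rfl⟩ := h
    have h2 : toG p κ' * pZ p ^ n * 1⁻¹ * toG p κ = toG p (κ' * κ) * pZ p ^ n * 1⁻¹ := by
      rw [inv_one, mul_one, mul_one, mul_assoc, pZ_zpow_comm, ← mul_assoc, ← map_mul]
    rw [h2, bracketFun_kz, bracketFun_kz, map_mul]
    rfl
  · rw [bracketFun_of_not _ _ _ h, bracketFun_of_not]
    rintro ⟨κ', n, h'⟩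
    refine h ⟨κ' * κ⁻¹, n, ?_⟩
    rw [← eq_mul_inv_iff_mul_eq] at h'
    rw [h', inv_one, mul_one, mul_one, mul_assoc, pZ_zpow_comm, ← mul_assoc, map_mul, map_inv]

lemma negl_symRep (κ : K p) {u : SymPow (Qbar p) r} (hu : u ∈ negl p r a) :
    symRep (toQbar p) r κ u ∈ negl p r a := by
  obtain ⟨F, hF⟩ := hu
  refine ⟨indRep _ (toG p κ) F, fun g => ?_⟩
  rw [bracket_one_symRep, heckeT_comm, indRep_apply, indRep_apply, indRep_apply]
  exact hF (g * toG p κ)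

/-- The values of `T [g, v]` involve `δ κ v` with `κ` in `K` arbitrary. Moving `K` to the left
leaves finitely many matrices to test, since smallness is stable under `K`. -/
lemma exists_transpose_heckeMat (i : Option (ZMod p)) (κ : K p) :
    ∃ (i' : Option (ZMod p)) (τ : K p), heckeMat p i * κ.1 = τ.1 * (heckeMat p i')ᵀ := by
  obtain ⟨i', τ, h⟩ := exists_heckeMat_mul p (heckeMat p i * κ.1)ᵀ κ.det (by
    rw [Matrix.det_transpose, Matrix.det_mul, heckeMat_det]
    rfl)
  refine ⟨i', Matrix.GeneralLinearGroup.mk'' τ.1ᵀ (by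
    rw [Matrix.det_transpose]
    exact τ.det.isUnit), ?_⟩
  have h' := congrArg Matrix.transpose h
  rw [Matrix.transpose_transpose, Matrix.transpose_mul] at h'
  exact h'

lemma symEnd_heckeMat_symRep {i i' : Option (ZMod p)} {κ τ : K p}
    (h : heckeMat p i * κ.1 = τ.1 * (heckeMat p i')ᵀ) (v : SymPow (Qbar p) r) :
    symEnd r ((heckeMat p i).map (toQbar p)) (symRep (toQbar p) r κ v) =
      symRep (toQbar p) r τ (symEnd r ((heckeMat p i')ᵀ.map (toQbar p)) v) := by
  rw [symRep_apply, symRep_apply, ← Module.End.mul_apply, ← Module.End.mul_apply, ← map_mul,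
    ← map_mul]
  have hM := congrArg (fun M => (toQbar p).mapMatrix M) h
  simp only [map_mul, RingHom.mapMatrix_apply] at hM
  rw [hM]

/-- For `F = -a⁻¹ [1, u]` the error `[1, u] - (T - a) F` equals `a⁻¹ T [1, u]`, whose values are
sums of `K`-translates of the polynomials in `hu`. -/
lemma mem_negl_of_heckeMat (ha : a ≠ 0) {u : SymPow (Qbar p) r}
    (hu : ∀ i, a⁻¹ • symEnd r ((heckeMat p i)ᵀ.map (toQbar p)) u ∈ smallSym p r) :
    u ∈ negl p r a := by
  refine ⟨-bracket _ 1 (a⁻¹ • u), fun g => ?_⟩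
  have h1 : (bracket (symRep (toQbar p) r) 1 u).1 g -
      ((heckeT (toQbar p) r (-bracket _ 1 (a⁻¹ • u))).1 g -
        a • (-bracket (symRep (toQbar p) r) 1 (a⁻¹ • u)).1 g) =
      (heckeT (toQbar p) r (bracket _ 1 (a⁻¹ • u))).1 g := by
    have h2 : ∀ f : IndQ p r, (-f).1 g = - f.1 g := fun _ => rfl
    rw [map_neg, h2, h2, map_smul (bracket _ 1), map_smul, ind_smul_apply, ind_smul_apply, smul_neg,
      smul_inv_smul₀ ha]
    abel
  rw [h1, heckeT_apply]
  refine sum_mem fun i _ => ?_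
  change symEnd r _ (bracketFun _ 1 _ _) ∈ _
  by_cases h : InCoset ((heckeG p i)⁻¹ * g) 1⁻¹
  · obtain ⟨κ, n, h⟩ := h
    rw [h, bracketFun_kz]
    obtain ⟨i', τ, hτ⟩ := exists_transpose_heckeMat i κ
    rw [symEnd_heckeMat_symRep hτ, map_smul]
    exact smallSym_symRep τ (hu i')
  · rw [bracketFun_of_not _ _ _ h, map_zero]
    exact zero_mem _

lemma transpose_heckeMat_none : (heckeMat p none)ᵀ = heckeMat p none := by
  ext i j
  fin_cases i <;> fin_cases j <;> rfl

/-- Comparing norms of determinants excludes a nontrivial power of the central element `p`; then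
`heckeMat_unique` separates the representatives. -/
lemma inCoset_heckeG_iff {i : Option (ZMod p)} :
    InCoset (heckeG p i)⁻¹ (heckeG p none)⁻¹ ↔ i = none := by
  constructor
  · rintro ⟨κ, n, h⟩
    have hdet : ∀ i, ((heckeG p i).det : ℚ_[p]) = p := by
      intro i
      have : ((heckeG p i).det : ℚ_[p]) = (((heckeMat p i).det : ℤ_[p]) : ℚ_[p]) :=
        (RingHom.map_det PadicInt.Coe.ringHom (heckeMat p i)).symm
      rw [this, heckeMat_det]
      simp
    have hn : n = 0 := by
      have hd := congrArg (fun g : G p => ‖(g.det : ℚ_[p])‖) h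
      have hp1 : (1 : ℝ) < p := by exact_mod_cast (Fact.out : p.Prime).one_lt
      simp only [map_mul, map_zpow, map_inv, Units.val_mul, Units.val_zpow_eq_zpow_val, norm_mul,
        norm_zpow, norm_det_toG, norm_det_pZ, one_mul, Units.val_inv_eq_inv_val, hdet, norm_inv]
        at hd
      have hp0 : (‖(p : ℚ_[p])‖⁻¹ : ℝ) ≠ 0 := by
        simp [(Fact.out : p.Prime).ne_zero]
      have hd' : (((p : ℝ) ^ 2)⁻¹) ^ n = (((p : ℝ) ^ 2)⁻¹) ^ (0 : ℤ) := by
        rw [zpow_zero]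
        exact mul_right_cancel₀ hp0 (by rw [← hd, one_mul])
      refine zpow_right_injective₀ (a := ((p : ℝ) ^ 2)⁻¹) (by positivity) ?_ hd'
      have : (1 : ℝ) < (p : ℝ) ^ 2 := by nlinarith
      exact (inv_lt_one_of_one_lt₀ this).ne
    subst hn
    rw [zpow_zero, mul_one, inv_eq_iff_eq_inv, mul_inv_rev, inv_inv, ← map_inv] at h
    apply heckeMat_unique p (κ := κ⁻¹)
    have h' := congrArg (fun g : G p => g.1) h
    ext i' j'
    have h2 := congrFun (congrFun h' i') j'
    apply Subtype.ext
    refine h2.trans ?_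
    have h3 : ∀ M N : Matrix (Fin 2) (Fin 2) ℤ_[p], (M * N).map (PadicInt.Coe.ringHom (p := p)) =
        M.map (PadicInt.Coe.ringHom (p := p)) * N.map (PadicInt.Coe.ringHom (p := p)) :=
      fun M N => map_mul (PadicInt.Coe.ringHom (p := p)).mapMatrix M N
    exact (congrFun (congrFun (h3 (heckeMat p none) (κ⁻¹).1) i') j').symm
  · rintro rfl
    exact InCoset.refl _

/-- Take `F = [δ, v]` with `δ = (1, 0; 0, p)`. At the identity only the term of `δ` in `T F`
survives, and it cancels `[1, δ v]`. Outside `KZ` only matrices covered by `hv` occur, and `a F` is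
small by `hav`. -/
lemma symEnd_heckeMat_none_mem_negl {v : SymPow (Qbar p) r} (hav : a • v ∈ smallSym p r)
    (hv : ∀ l, symEnd r ((heckeMat p (some l))ᵀ.map (toQbar p)) v ∈ smallSym p r) :
    symEnd r ((heckeMat p none).map (toQbar p)) v ∈ negl p r a := by
  classical
  set D := symEnd r ((heckeMat p none).map (toQbar p)) v with hD
  refine ⟨bracket _ (heckeG p none) v, fun g => ?_⟩
  rw [← sub_add]
  refine add_mem ?_ ?_
  · by_cases hg : InCoset g 1
    · obtain ⟨τ, n, rfl⟩ := hg
      rw [ind_kz, ind_kz, ← map_sub]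
      suffices h : (bracket (symRep (toQbar p) r) 1 D).1 1 -
          (heckeT (toQbar p) r (bracket _ (heckeG p none) v)).1 1 = 0 by
        rw [h, map_zero]
        exact zero_mem _
      rw [heckeT_apply, Finset.sum_eq_single none]
      · have h1 := bracketFun_kz (symRep (toQbar p) r) 1 D 1 0
        have h2 := bracketFun_kz (symRep (toQbar p) r) (heckeG p none) v 1 0
        simp only [map_one, zpow_zero, mul_one, one_mul, inv_one, Module.End.one_apply] at h1 h2
        rw [mul_one]
        change bracketFun _ 1 D 1 - symEnd r _ (bracketFun _ (heckeG p none) v (heckeG p none)⁻¹) = 0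
        rw [h1, h2, hD, sub_self]
      · intro i _ hi
        change symEnd r _ (bracketFun _ _ _ _) = 0
        rw [bracketFun_of_not, map_zero]
        rw [mul_one]
        exact fun h => hi (inCoset_heckeG_iff.1 h)
      · simp
    · have h1 : (bracket (symRep (toQbar p) r) 1 D).1 g = 0 :=
        bracketFun_of_not _ _ _ (by rwa [inv_one])
      rw [h1, zero_sub, heckeT_apply]
      refine neg_mem (sum_mem fun i _ => ?_)
      change symEnd r _ (bracketFun _ _ _ _) ∈ _
      by_cases h : InCoset ((heckeG p i)⁻¹ * g) (heckeG p none)⁻¹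
      · obtain ⟨κ, n, h⟩ := h
        rw [h, bracketFun_kz]
        obtain ⟨i', τ, hτ⟩ := exists_transpose_heckeMat i κ
        rw [symEnd_heckeMat_symRep hτ]
        apply smallSym_symRep
        cases i' with
        | some l => exact hv l
        | none =>
          -- The transposed diagonal matrix would place `g` in `KZ`.
          exfalso
          apply hg
          refine ⟨τ, n, ?_⟩
          have hG : heckeG p i * toG p κ = toG p τ * heckeG p none := by
            rw [transpose_heckeMat_none] at hτ
            apply Units.ext
            have := congrArg (fun M => (PadicInt.Coe.ringHom (p := p)).mapMatrix M) hτ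
            simp only [map_mul] at this
            exact this
          rw [inv_mul_eq_iff_eq_mul, mul_assoc (toG p κ), pZ_zpow_comm, ← mul_assoc, ← mul_assoc,
            hG, mul_inv_cancel_right] at h
          rw [h, mul_one]
      · rw [bracketFun_of_not _ _ _ h, map_zero]
        exact zero_mem _
  · rw [← ind_smul_apply, ← map_smul]
    change bracketFun _ _ _ _ ∈ _
    by_cases h : InCoset g (heckeG p none)⁻¹
    · obtain ⟨κ, n, rfl⟩ := h
      rw [bracketFun_kz]
      exact smallSym_symRep κ hav
    · rw [bracketFun_of_not _ _ _ h]
      exact zero_mem _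

lemma norm_algebraMap_le_one (z : Zbar p) : ‖algebraMap (Zbar p) (Qbar p) z‖ ≤ 1 := by
  have h : Valued.v (z : Qbar p) ≤ 1 := z.2
  rw [PadicAlgCl.valuation_def] at h
  exact_mod_cast h

lemma exists_eq_algebraMap {x : Qbar p} (hx : ‖x‖ ≤ 1) :
    ∃ z : Zbar p, algebraMap (Zbar p) (Qbar p) z = x := by
  refine ⟨⟨x, ?_⟩, rfl⟩
  change Valued.v x ≤ 1
  rw [PadicAlgCl.valuation_def]
  exact_mod_cast hx

lemma toRes_eq_zero_of_norm_lt {z : Zbar p} (hz : ‖algebraMap (Zbar p) (Qbar p) z‖ < 1) :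
    toRes p z = 0 := by
  rw [toRes_eq_zero_iff, IsLocalRing.mem_maximalIdeal, mem_nonunits_iff]
  rintro ⟨u, rfl⟩
  have h := norm_algebraMap_le_one ((u⁻¹ : (Zbar p)ˣ) : Zbar p)
  have h1 : algebraMap (Zbar p) (Qbar p) u * algebraMap (Zbar p) (Qbar p) ((u⁻¹ : (Zbar p)ˣ)) = 1 := by
    rw [← map_mul, Units.mul_inv, map_one]
  have h2 := congrArg norm h1
  rw [norm_mul, norm_one] at h2
  nlinarith [norm_nonneg (algebraMap (Zbar p) (Qbar p) u)]

lemma norm_natCast_p : ‖(p : Qbar p)‖ = (p : ℝ)⁻¹ := by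
  rw [← PadicAlgCl.valuation_coe, PadicAlgCl.valuation_p]
  simp

lemma smul_incl_mem_smallSym {x : Qbar p} {n : ℕ} {f : SymPow (Zbar p) r}
    (hf : (p : MvPolynomial (Fin 2) (Zbar p)) ^ n ∣ f.poly) (hx : ‖x‖ * (p : ℝ)⁻¹ ^ n < 1) :
    x • incl p r f ∈ smallSym p r := by
  obtain ⟨q, hq⟩ := hf
  obtain ⟨z, hz⟩ := exists_eq_algebraMap (p := p) (x := x * (p : Qbar p) ^ n) (by
    rw [norm_mul, norm_pow, norm_natCast_p]
    exact hx.le)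
  have hz0 : toRes p z = 0 := toRes_eq_zero_of_norm_lt (by
    rw [hz, norm_mul, norm_pow, norm_natCast_p]
    exact hx)
  -- The quotient `q` is not known to be homogeneous; its component of degree `r` is an equally good
  -- quotient.
  have hq' : f.poly = (p : MvPolynomial (Fin 2) (Zbar p)) ^ n * homogeneousComponent r q := by
    have h1 : homogeneousComponent r f.poly = f.poly := by
      rw [homogeneousComponent_of_mem f.isHomogeneous, if_pos rfl]
    rw [← h1, hq, ← map_natCast (C : Zbar p →+* _), ← map_pow, homogeneousComponent_C_mul]
  refine ⟨z • SymPow.mk _ (homogeneousComponent_isHomogeneous r q), ?_, ?_⟩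
  · rw [LinearMap.map_smulₛₗ, hz]
    ext1
    rw [map_smul, map_smul, incl, symMap_poly, symMap_poly, SymPow.poly_mk, hq', map_mul, map_pow,
      map_natCast, smul_eq_C_mul, smul_eq_C_mul, map_mul, map_pow, map_natCast, mul_assoc]
  · rw [LinearMap.map_smulₛₗ, hz0, zero_smul]

lemma symEnd_incl (M : Matrix (Fin 2) (Fin 2) ℤ_[p]) (f : SymPow (Zbar p) r) :
    symEnd r (M.map (toQbar p)) (incl p r f) = incl p r (symEnd r (M.map (toZbar p)) f) := by
  rw [incl, symMap_symEnd, Matrix.map_map]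
  rfl

lemma smul_incl_mem_negl_of_dvd {x : Qbar p} {n : ℕ} {f : SymPow (Zbar p) r}
    (hf : (p : MvPolynomial (Fin 2) (Zbar p)) ^ n ∣ f.poly) (hx : ‖x‖ * (p : ℝ)⁻¹ ^ n < 1) :
    x • incl p r f ∈ negl p r a :=
  smallSym_le_negl (smul_incl_mem_smallSym hf hx)

lemma smul_incl_mem_negl_of_heckeMat (ha : a ≠ 0) {x : Qbar p} {n : ℕ} {f : SymPow (Zbar p) r}
    (hf : ∀ i, (p : MvPolynomial (Fin 2) (Zbar p)) ^ n ∣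
      subst ((heckeMat p i)ᵀ.map (toZbar p)) f.poly)
    (hx : ‖x‖ * (p : ℝ)⁻¹ ^ n < ‖a‖) : x • incl p r f ∈ negl p r a := by
  refine mem_negl_of_heckeMat ha fun i => ?_
  rw [map_smul, symEnd_incl, smul_smul]
  refine smul_incl_mem_smallSym (n := n) (hf i) ?_
  have ha' : 0 < ‖a‖ := norm_pos_iff.2 ha
  rw [norm_mul, norm_inv, mul_assoc, inv_mul_lt_iff₀ ha', mul_one]
  exact hx

lemma smul_incl_symEnd_mem_negl {x : Qbar p} {n : ℕ} {f : SymPow (Zbar p) r}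
    (hf : ∀ l, (p : MvPolynomial (Fin 2) (Zbar p)) ^ n ∣
      subst ((heckeMat p (some l))ᵀ.map (toZbar p)) f.poly)
    (hx : ‖x‖ * (p : ℝ)⁻¹ ^ n < 1) (hax : ‖a‖ * ‖x‖ < 1) :
    x • incl p r (symEnd r ((heckeMat p none).map (toZbar p)) f) ∈ negl p r a := by
  rw [← symEnd_incl, ← map_smul]
  refine symEnd_heckeMat_none_mem_negl ?_ fun l => ?_
  · rw [smul_smul]
    exact smul_incl_mem_smallSym (n := 0) (by simp) (by simpa using hax)
  · rw [map_smul, symEnd_incl]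
    exact smul_incl_mem_smallSym (n := n) (hf l) hx

end Negligible

/-! ### Isolating monomials by interpolation on a residue class modulo `p - 1` -/

section Interpolation

lemma not_dvd_choose_of_lt {p n k : ℕ} (hp : p.Prime) (hn : n < p) (hk : k ≤ n) :
    ¬ p ∣ n.choose k := by
  intro h
  have h1 : p ∣ n.factorial := by
    rw [← Nat.choose_mul_factorial_mul_factorial hk, mul_assoc]
    exact h.mul_right _
  exact absurd ((hp.dvd_factorial).1 h1) (by omega)

/-- A case of Lucas' theorem. -/
lemma not_dvd_choose_add_mul {p n₀ n₁ k₀ k₁ : ℕ} [hp : Fact p.Prime] (hn₀ : n₀ < p) (hn₁ : n₁ < p)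
    (hk₀ : k₀ ≤ n₀) (hk₁ : k₁ ≤ n₁) : ¬ p ∣ (n₀ + p * n₁).choose (k₀ + p * k₁) := by
  have h := Choose.choose_modEq_choose_mod_mul_choose_div_nat (n := n₀ + p * n₁)
    (k := k₀ + p * k₁) (p := p)
  rw [Nat.add_mul_mod_self_left, Nat.add_mul_mod_self_left, Nat.mod_eq_of_lt hn₀,
    Nat.mod_eq_of_lt (hk₀.trans_lt hn₀), Nat.add_mul_div_left _ _ hp.out.pos,
    Nat.add_mul_div_left _ _ hp.out.pos, Nat.div_eq_of_lt hn₀, Nat.div_eq_of_lt (hk₀.trans_lt hn₀),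
    zero_add, zero_add] at h
  rw [h.dvd_iff dvd_rfl, hp.out.dvd_mul]
  exact not_or.2 ⟨not_dvd_choose_of_lt hp.out hn₀ hk₀, not_dvd_choose_of_lt hp.out hn₁ hk₁⟩

variable {F V : Type*} [Field F] [AddCommGroup V] [Module F V] (N : AddSubgroup V)

/-- Every integral polynomial of degree at most `n` is an integral combination of the first `n + 1`
falling factorials. -/
lemma map_mem_of_descPochhammer (Φ : Polynomial ℤ →+ V) (n : ℕ)
    (h : ∀ j ≤ n, Φ (descPochhammer ℤ j) ∈ N) (f : Polynomial ℤ) (hf : f.natDegree ≤ n) :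
    Φ f ∈ N := by
  induction n generalizing f with
  | zero =>
    have hf' : f = f.coeff 0 • descPochhammer ℤ 0 := by
      rw [descPochhammer_zero, Polynomial.smul_eq_C_mul, mul_one]
      exact Polynomial.eq_C_of_natDegree_le_zero hf
    rw [hf', map_zsmul]
    exact N.zsmul_mem (h 0 le_rfl) _
  | succ n ih =>
    have hd : (descPochhammer ℤ (n + 1)).natDegree = n + 1 := descPochhammer_natDegree ℤ (n + 1)
    have hm : (descPochhammer ℤ (n + 1)).coeff (n + 1) = 1 := by
      have := monic_descPochhammer ℤ (n + 1)
      rwa [Polynomial.Monic, Polynomial.leadingCoeff, hd] at this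
    have hf' : f = (f - f.coeff (n + 1) • descPochhammer ℤ (n + 1)) +
        f.coeff (n + 1) • descPochhammer ℤ (n + 1) := by abel
    rw [hf', map_add, map_zsmul]
    refine N.add_mem (ih (fun j hj => h j (by omega)) _ ?_) (N.zsmul_mem (h _ le_rfl) _)
    rw [Polynomial.natDegree_le_iff_coeff_eq_zero]
    intro m hmn
    rw [Polynomial.coeff_sub, Polynomial.coeff_smul]
    rcases Nat.lt_or_ge (n + 1) m with h' | h'
    · rw [Polynomial.coeff_eq_zero_of_natDegree_lt (by omega : f.natDegree < m),
        Polynomial.coeff_eq_zero_of_natDegree_lt (hd.trans_lt h'), smul_zero, sub_zero]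
    · obtain rfl : m = n + 1 := by omega
      rw [hm, smul_eq_mul, mul_one, sub_self]

/-- `f ↦ ∑ (s choose e) f(e) m_e`, the sum running over the `e` in `I`. -/
def chooseSum (mon : ℕ → V) (s : ℕ) (I : Finset ℕ) : Polynomial ℤ →+ V where
  toFun f := ∑ e ∈ I, ((s.choose e : ℤ) * f.eval (e : ℤ)) • mon e
  map_zero' := by simp
  map_add' f g := by simp [mul_add, add_smul, Finset.sum_add_distrib]

/-- Take `f = ∏ (X - e')` over `J`: the terms in `J` vanish, and the remaining ones other than `e`
lie in `N` already. -/
lemma smul_mem_of_vanishing (mon : ℕ → V) (s : ℕ) (I J : Finset ℕ) (x : F) (n e : ℕ)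
    (hΦ : ∀ f : Polynomial ℤ, f.natDegree ≤ n → x • chooseSum mon s I f ∈ N)
    (he : e ∈ I) (hJ : J.card ≤ n) (hIJ : ∀ e' ∈ I, e' ∈ J ∨ e' = e ∨ x • mon e' ∈ N) :
    ((s.choose e : ℤ) * ∏ e' ∈ J, ((e : ℤ) - e')) • x • mon e ∈ N := by
  let f : Polynomial ℤ := ∏ e' ∈ J, (Polynomial.X - Polynomial.C (e' : ℤ))
  have hev : ∀ e'' : ℕ, f.eval (e'' : ℤ) = ∏ e' ∈ J, ((e'' : ℤ) - e') := by
    intro e''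
    simp [f, Polynomial.eval_prod]
  have h := hΦ f (by
    simp only [f, Polynomial.natDegree_finsetProd_X_sub_C_eq_card]
    exact hJ)
  change x • ∑ e ∈ I, ((s.choose e : ℤ) * f.eval (e : ℤ)) • mon e ∈ N at h
  rw [← Finset.add_sum_erase _ _ he, smul_add] at h
  have h2 : x • ∑ e' ∈ I.erase e, ((s.choose e' : ℤ) * f.eval (e' : ℤ)) • mon e' ∈ N := by
    rw [Finset.smul_sum]
    refine sum_mem fun e' he' => ?_
    rw [Finset.mem_erase] at he'
    rcases hIJ e' he'.2 with h3 | h3 | h3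
    · have : f.eval (e' : ℤ) = 0 := by
        rw [hev]
        exact Finset.prod_eq_zero h3 (sub_self _)
      rw [this, mul_zero, zero_smul, smul_zero]
      exact N.zero_mem
    · exact absurd h3 he'.1
    · rw [smul_comm]
      exact N.zsmul_mem h3 _
  have h3 := N.sub_mem h h2
  rw [add_sub_cancel_right, smul_comm, hev] at h3
  exact h3

/-- Each factor is `(l - l') (p - 1)` with `0 < |l - l'| ≤ c + 1 < p`, hence prime to `p`. -/
lemma not_dvd_prod_sub {p : ℕ} [hp : Fact p.Prime] {e₀ l c : ℕ} {J : Finset ℕ} (hc : c + 1 < p)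
    (hl : l ≤ c + 1) (hJ : ∀ l' ∈ J, l' ≤ c + 1 ∧ l' ≠ l) :
    ¬ (p : ℤ) ∣ ∏ e' ∈ J.image (fun l' => e₀ + l' * (p - 1)),
      (((e₀ + l * (p - 1) : ℕ) : ℤ) - e') := by
  have hp' : Prime (p : ℤ) := Nat.prime_iff_prime_int.1 hp.out
  rw [hp'.dvd_finsetProd_iff]
  rintro ⟨e', he', h⟩
  obtain ⟨l', hl', rfl⟩ := Finset.mem_image.1 he'
  obtain ⟨h1, h2⟩ := hJ l' hl'
  have hp1 : ((p - 1 : ℕ) : ℤ) = p - 1 := by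
    rw [Nat.cast_sub hp.out.one_le, Nat.cast_one]
  have h3 : (((e₀ + l * (p - 1) : ℕ) : ℤ) - ((e₀ + l' * (p - 1) : ℕ) : ℤ)) =
      (l - l') * (p - 1) := by
    push_cast [hp1]
    ring
  rw [h3, hp'.dvd_mul] at h
  rcases h with h | h
  · have h4 : (l : ℤ) - l' = 0 := Int.eq_zero_of_abs_lt_dvd h (by rw [abs_lt]; omega)
    omega
  · have h4 : (p : ℤ) ∣ 1 := by
      have := (dvd_refl (p : ℤ)).sub h
      rwa [sub_sub_cancel] at this
    exact hp'.not_dvd_one h4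

/-- The exponents up to `s` in the class of `k` modulo `q`. -/
def residueClass (q s k : ℕ) : Finset ℕ := {e ∈ Finset.range (s + 1) | e % q = k % q}

lemma choose_mul_descFactorial {s e j : ℕ} (hje : j ≤ e) :
    s.descFactorial j * (s - j).choose (e - j) = s.choose e * e.descFactorial j := by
  have h := Nat.choose_mul (n := s) hje
  rw [Nat.descFactorial_eq_factorial_mul_choose, Nat.descFactorial_eq_factorial_mul_choose,
    mul_assoc, ← h]
  ring

lemma smul_mem_of_pow_smul_mem {p c j n : ℕ} (hj : j ≤ n) {v : V}
    (h : ((p : F) ^ j * ((p : F) ^ c)⁻¹) • v ∈ N) : ((p : F) ^ n * ((p : F) ^ c)⁻¹) • v ∈ N := by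
  have h1 := N.nsmul_mem h (p ^ (n - j))
  rw [← Nat.cast_smul_eq_nsmul F, smul_smul, ← mul_assoc, Nat.cast_pow, ← pow_add,
    Nat.sub_add_cancel hj] at h1
  exact h1

section

variable {p : ℕ} (mon : ℕ → V) {b c s : ℕ}

/-- By `choose_mul_descFactorial` the sum for the falling factorial is an integer multiple of the
given one, so no division is needed. -/
lemma chooseSum_descPochhammer_mem (x : F) (k j : ℕ)
    (h : x • ∑ e ∈ residueClass (p - 1) s k with j ≤ e, (s - j).choose (e - j) • mon e ∈ N) :
    x • chooseSum mon s (residueClass (p - 1) s k) (descPochhammer ℤ j) ∈ N := by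
  have h2 : x • chooseSum mon s (residueClass (p - 1) s k) (descPochhammer ℤ j) =
      s.descFactorial j • x • ∑ e ∈ residueClass (p - 1) s k with j ≤ e,
        (s - j).choose (e - j) • mon e := by
    rw [smul_comm (s.descFactorial j) x, Finset.smul_sum, Finset.sum_filter]
    change x • ∑ e ∈ residueClass (p - 1) s k,
      ((s.choose e : ℤ) * (descPochhammer ℤ j).eval (e : ℤ)) • mon e = _
    congr 1
    refine Finset.sum_congr rfl fun e he => ?_
    have hes : e ≤ s := by
      simp only [residueClass, Finset.mem_filter, Finset.mem_range] at he
      omega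
    rw [descPochhammer_eval_eq_descFactorial]
    split_ifs with hje
    · rw [smul_smul, choose_mul_descFactorial hje, ← Nat.cast_mul, natCast_zsmul]
    · rw [Nat.descFactorial_eq_zero_iff_lt.2 (by omega), Nat.cast_zero, mul_zero, zero_smul]
  rw [h2]
  exact N.nsmul_mem h _

-- `N` stands for the negligible polynomials and `mon e` for `E^N x^(s - e) y^e`. The hypotheses
-- `h0` and `hs0` concern the two ends of the range of exponents, `hk` the unipotent translates
-- after projection to a torus character.
variable [hp : Fact p.Prime] (hpF : (p : F) ≠ 0) (hN : ∀ (n : ℤ) (v : V), ¬ (p : ℤ) ∣ n → n • v ∈ N → v ∈ N)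
  (h0 : ∀ j ≤ c, ((p : F) ^ j * ((p : F) ^ c)⁻¹) • mon j ∈ N)
  (hs0 : ∀ j ≤ c, ((p : F) ^ j * ((p : F) ^ c)⁻¹) • mon (s - j) ∈ N)
  (hk : ∀ j ≤ c, ∀ k, ((p : F) ^ j * ((p : F) ^ c)⁻¹) •
    ∑ e ∈ residueClass (p - 1) s k with j ≤ e, (s - j).choose (e - j) • mon e ∈ N)

include hpF hN h0 hs0 hk in
/-- The combinatorial criterion: it is enough to interpolate on the residue class of `e`, using
`n ∈ {c - 1, c}` as the bound for the degree. -/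
lemma mem_of_interpolation {n e₀ l : ℕ} {J : Finset ℕ} (hc : c + 1 < p) (hn : n ≤ c)
    (hsp : s < p ^ 2) (he₀ : e₀ < p - 1) (hl : e₀ + l * (p - 1) ≤ s) (hlc : l ≤ c + 1)
    (hunit : c = n + 1 ∨ ¬ p ∣ s.choose (e₀ + l * (p - 1))) (hJn : J.card ≤ n)
    (hJ : ∀ l' ∈ J, l' ≤ c + 1 ∧ l' ≠ l)
    (hIJ : ∀ l', e₀ + l' * (p - 1) ≤ s → l' ∈ J ∨ l' = l ∨ e₀ + l' * (p - 1) ≤ n ∨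
      s ≤ n + (e₀ + l' * (p - 1))) :
    mon (e₀ + l * (p - 1)) ∈ N := by
  set e := e₀ + l * (p - 1) with he
  set x : F := (p : F) ^ n * ((p : F) ^ c)⁻¹ with hx
  have hmod : ∀ e', e' ∈ residueClass (p - 1) s e₀ →
      ∃ l', e' = e₀ + l' * (p - 1) ∧ e₀ + l' * (p - 1) ≤ s := by
    intro e' he'
    simp only [residueClass, Finset.mem_filter, Finset.mem_range, Nat.mod_eq_of_lt he₀] at he'
    have h1 : e₀ + e' / (p - 1) * (p - 1) = e' := by
      rw [← he'.2, add_comm, mul_comm, Nat.div_add_mod]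
    exact ⟨e' / (p - 1), h1.symm, by omega⟩
  have key := smul_mem_of_vanishing N mon s (residueClass (p - 1) s e₀)
    (J.image (fun l' => e₀ + l' * (p - 1))) x n e ?_ ?_ (Finset.card_image_le.trans hJn) ?_
  · have hprod := not_dvd_prod_sub (p := p) (e₀ := e₀) hc hlc hJ
    rw [mul_comm, mul_smul] at key
    rw [← he] at hprod
    have key2 := hN _ _ hprod key
    rw [natCast_zsmul] at key2
    have hes : 0 < s.choose e := Nat.choose_pos hl
    -- Since `s < p ^ 2`, the binomial coefficient contains `p` at most once. If it does, then `c =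
    -- n + 1`, so `x = p⁻¹` cancels exactly this factor.
    by_cases hdvd : p ∣ s.choose e
    · have hnc : n + 1 = c := by
        rcases hunit with h1 | h2
        · omega
        · exact absurd hdvd h2
      obtain ⟨m, hm⟩ := hdvd
      have hpm : ¬ p ∣ m := by
        intro hpm
        have h1 : p ^ 2 ∣ s.choose e := by
          rw [hm, pow_two]
          exact Nat.mul_dvd_mul_left p hpm
        have h2 := (hp.out.pow_dvd_iff_le_factorization hes.ne').1 h1
        have h3 := Nat.factorization_choose_le_one (p := p) (n := s) (k := e) hsp
        omega
      have hxp : (p : F) * x = 1 := by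
        rw [hx, ← hnc, ← mul_assoc, ← pow_succ', mul_inv_cancel₀ (pow_ne_zero _ hpF)]
      rw [hm, mul_comm, mul_smul, ← Nat.cast_smul_eq_nsmul F p, smul_smul, hxp, one_smul] at key2
      refine hN m _ (by exact_mod_cast hpm) ?_
      rw [natCast_zsmul]
      exact key2
    · have key3 := hN (s.choose e) (x • mon e) (by exact_mod_cast hdvd)
        (by rw [natCast_zsmul]; exact key2)
      have key4 := smul_mem_of_pow_smul_mem N hn key3
      rwa [mul_inv_cancel₀ (pow_ne_zero _ hpF), one_smul] at key4
  · intro f hf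
    let Φ : Polynomial ℤ →+ V :=
      (DistribSMul.toAddMonoidHom V x).comp (chooseSum mon s (residueClass (p - 1) s e₀))
    refine map_mem_of_descPochhammer N Φ n (fun j hj => ?_) f hf
    exact chooseSum_descPochhammer_mem N mon x e₀ j
      (smul_mem_of_pow_smul_mem N hj (hk j (hj.trans hn) e₀))
  · simp only [residueClass, Finset.mem_filter, Finset.mem_range, he]
    exact ⟨by omega, by rw [Nat.add_mul_mod_self_right]⟩
  · intro e' he'
    obtain ⟨l', rfl, hl's⟩ := hmod e' he'
    rcases hIJ l' hl's with h | h | h | h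
    · exact Or.inl (Finset.mem_image.2 ⟨l', h, rfl⟩)
    · right; left
      rw [h]
    · right; right
      exact smul_mem_of_pow_smul_mem N h (h0 _ (h.trans hn))
    · right; right
      have h1 := smul_mem_of_pow_smul_mem N (j := s - (e₀ + l' * (p - 1))) (n := n)
        (by omega) (hs0 _ (by omega))
      rwa [Nat.sub_sub_self hl's] at h1

include hpF hN h0 hs0 hk in
-- With `q = p - 1`, the class `e₀ + l q ≤ b + c q` has `c`, `c + 1` or `c + 2` elements, according
-- to the position of `b` relative to `e₀` and `e₀ + q`. Exponents within `n` of either end need not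
-- be killed. Degree `n = c - 1` tolerates a factor `p` in the binomial coefficient; degree `n = c`
-- requires the coefficient to be prime to `p`.
theorem forall_mem_of_interpolation (hc1 : 1 ≤ c) (hc : c + 1 < p) (hb : 2 ≤ b) (hbp : b ≤ p)
    (hs : s = b + c * (p - 1)) (e : ℕ) (hes : e ≤ s) : mon e ∈ N := by
  have hp1 : 0 < p - 1 := by omega
  obtain ⟨q, rfl⟩ : ∃ q, p = q + 1 := ⟨p - 1, by omega⟩
  simp only [Nat.add_sub_cancel] at *
  have hfree : ∀ e, (e ≤ c ∨ s ≤ c + e) → e ≤ s → mon e ∈ N := by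
    rintro e (h | h) hes
    · have := smul_mem_of_pow_smul_mem N h (h0 e h)
      rwa [mul_inv_cancel₀ (pow_ne_zero _ hpF), one_smul] at this
    · have := smul_mem_of_pow_smul_mem N (j := s - e) (n := c) (by omega) (hs0 (s - e) (by omega))
      rwa [mul_inv_cancel₀ (pow_ne_zero _ hpF), one_smul, Nat.sub_sub_self hes] at this
  have hsp : s < (q + 1) ^ 2 := by
    have : c * q ≤ (q - 1) * q := Nat.mul_le_mul_right _ (by omega)
    obtain ⟨q', rfl⟩ : ∃ q', q = q' + 1 := ⟨q - 1, by omega⟩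
    simp only [Nat.add_sub_cancel] at this
    nlinarith
  by_cases hfr : e ≤ c ∨ s ≤ c + e
  · exact hfree e hfr hes
  obtain ⟨e₀, l, he₀, rfl⟩ : ∃ e₀ l, e₀ < q ∧ e = e₀ + l * q :=
    ⟨e % q, e / q, Nat.mod_lt _ hp1, by rw [add_comm, mul_comm, Nat.div_add_mod]⟩
  have hmul : ∀ l', l' * q + q ≤ c * q ∨ l' = c ∨ (l' = c + 1 ∧ l' * q = c * q + q) ∨
      c * q + 2 * q ≤ l' * q := by
    intro l'
    rcases Nat.lt_trichotomy l' c with h | h | h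
    · left
      have := Nat.mul_le_mul_right q h
      rwa [Nat.succ_mul] at this
    · exact Or.inr (Or.inl h)
    · rcases Nat.lt_or_ge (c + 1) l' with h' | h'
      · right; right; right
        have := Nat.mul_le_mul_right q h'
        rw [Nat.succ_mul, Nat.succ_mul] at this
        omega
      · right; right; left
        have : l' = c + 1 := by omega
        exact ⟨this, by rw [this, Nat.succ_mul]⟩
  have hlt : ∀ l', l' * q + q ≤ c * q → l' < c := by
    intro l' h
    by_contra hc'
    have := Nat.mul_le_mul_right q (not_lt.1 hc')
    omega
  have hz : ∀ l', l' = 0 → l' * q = 0 := by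
    rintro _ rfl
    exact zero_mul q
  have hlz := hz l
  have hml := hmul l
  have hltl := hlt l
  have hcl : l = c → l * q = c * q := fun h => by rw [h]
  have happ : ∀ (n : ℕ) (J : Finset ℕ), _ := fun n J =>
    mem_of_interpolation (p := q + 1) N mon hpF hN h0 hs0 hk (n := n) (J := J) (e₀ := e₀) (l := l) hc
  simp only [Nat.add_sub_cancel] at happ
  -- For `b < e₀`, `l` runs up to `c - 1`, leaving `c - 1` exponents to kill.
  rcases Nat.lt_or_ge b e₀ with h1 | h1
  · have hl : l < c := by omega
    refine happ (c - 1) ((Finset.range c).erase l) (by omega) hsp he₀ hes (by omega)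
      (Or.inl (by omega)) ?_ ?_ ?_
    · rw [Finset.card_erase_of_mem (Finset.mem_range.2 hl), Finset.card_range]
    · intro l' hl'
      simp only [Finset.mem_erase, Finset.mem_range] at hl'
      omega
    · intro l' hl'
      have := hmul l'
      have := hlt l'
      have : l' = c → l' * q = c * q := fun h => by rw [h]
      simp only [Finset.mem_erase, Finset.mem_range]
      omega
  -- For `e₀ ≤ b < e₀ + q`, `l` runs up to `c`, leaving `c` other exponents.
  rcases Nat.lt_or_ge b (e₀ + q) with h2 | h2
  · have hl : l ≤ c := by omega
    have hcard : ((Finset.range (c + 1)).erase l).card = c := by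
      rw [Finset.card_erase_of_mem (Finset.mem_range.2 (by omega)), Finset.card_range,
        Nat.add_sub_cancel]
    -- Here the exponent of `l₀ = 0` or `l₀ = c` is free even for `n = c - 1`. It differs from the
    -- target, which is not free.
    by_cases h3 : e₀ ≤ c - 1 ∨ b - e₀ ≤ c - 1
    · have h4 : ∃ l₀, l₀ ≤ c ∧ l₀ ≠ l ∧ (e₀ + l₀ * q ≤ c - 1 ∨ s ≤ c - 1 + (e₀ + l₀ * q)) := by
        rcases h3 with h3 | h3
        · refine ⟨0, by omega, by omega, by omega⟩
        · refine ⟨c, le_rfl, by omega, by omega⟩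
      obtain ⟨l₀, hl₀, hne, hfree₀⟩ := h4
      refine happ (c - 1) (((Finset.range (c + 1)).erase l).erase l₀) (by omega) hsp he₀ hes
        (by omega) (Or.inl (by omega)) ?_ ?_ ?_
      · rw [Finset.card_erase_of_mem (by simp only [Finset.mem_erase, Finset.mem_range]; omega),
          hcard]
      · intro l' hl'
        simp only [Finset.mem_erase, Finset.mem_range] at hl'
        omega
      · intro l' hl'
        have := hmul l'
        have := hlt l'
        have h5 : l' = l₀ → l' * q = l₀ * q := fun h => by rw [h]
        simp only [Finset.mem_erase, Finset.mem_range]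
        by_cases h6 : l' = l₀
        · have := h5 h6
          omega
        · omega
    -- Now `c ≤ e₀ ≤ b - c`. In base `p` the digits are `s = (b - c) + p c` and `e = (e₀ - l) + p
    -- l`, so Lucas applies and `n = c` is allowed.
    · refine happ c ((Finset.range (c + 1)).erase l) le_rfl hsp he₀ hes (by omega)
        (Or.inr ?_) hcard.le ?_ ?_
      · have h6 := not_dvd_choose_add_mul (p := q + 1) (n₀ := b - c) (n₁ := c) (k₀ := e₀ - l)
          (k₁ := l) (by omega) (by omega) (by omega) (by omega)
        have h7 : b - c + (q + 1) * c = s := by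
          rw [hs, Nat.succ_mul, mul_comm]
          omega
        have h8 : e₀ - l + (q + 1) * l = e₀ + l * q := by
          rw [Nat.succ_mul, mul_comm]
          omega
        rwa [h7, h8] at h6
      · intro l' hl'
        simp only [Finset.mem_erase, Finset.mem_range] at hl'
        omega
      · intro l' hl'
        have := hmul l'
        have := hlt l'
        simp only [Finset.mem_erase, Finset.mem_range]
        omega
  -- Here `b` is `q` or `q + 1` and `e₀ ≤ 1`. The class has `c + 2` elements, but those of `l = 0`
  -- and `l = c + 1` lie within `1` of the ends.
  · have hlc : l ≤ c + 1 := by omega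
    have hcq := Nat.succ_mul c q
    have hl0 : l ≠ 0 := by omega
    have hl1 : l ≠ c + 1 := by omega
    have hcard : ((((Finset.range (c + 2)).erase l).erase 0).erase (c + 1)).card = c - 1 := by
      rw [Finset.card_erase_of_mem (by simp only [Finset.mem_erase, Finset.mem_range]; omega),
        Finset.card_erase_of_mem (by simp only [Finset.mem_erase, Finset.mem_range]; omega),
        Finset.card_erase_of_mem (by simp only [Finset.mem_range]; omega), Finset.card_range]
      omega
    by_cases h3 : b = q ∨ 2 ≤ c
    · refine happ (c - 1) _ (by omega) hsp he₀ hes hlc (Or.inl (by omega)) hcard.le ?_ ?_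
      · intro l' hl'
        simp only [Finset.mem_erase, Finset.mem_range] at hl'
        omega
      · intro l' hl'
        have := hmul l'
        have := hlt l'
        have := hz l'
        simp only [Finset.mem_erase, Finset.mem_range]
        omega
    -- For `c = 1`, `b = p` the ends are free only for `n = 1`. Here `s = 2 p - 1`, and its binomial
    -- coefficients at `p - 1` and `p` are prime to `p`.
    · obtain rfl : c = 1 := by omega
      obtain rfl : l = 1 := by omega
      refine happ 1 _ (by omega) hsp he₀ hes hlc (Or.inr ?_) (hcard.le.trans (by omega)) ?_ ?_
      · rcases (by omega : e₀ = 0 ∨ e₀ = 1) with rfl | rfl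
        · have h6 := not_dvd_choose_add_mul (p := q + 1) (n₀ := q) (n₁ := 1) (k₀ := q)
            (k₁ := 0) (by omega) (by omega) (by omega) (by omega)
          have h7 : q + (q + 1) * 1 = s := by omega
          have h8 : q + (q + 1) * 0 = 0 + 1 * q := by omega
          rwa [h7, h8] at h6
        · have h6 := not_dvd_choose_add_mul (p := q + 1) (n₀ := q) (n₁ := 1) (k₀ := 0)
            (k₁ := 1) (by omega) (by omega) (by omega) (by omega)
          have h7 : q + (q + 1) * 1 = s := by omega
          have h8 : 0 + (q + 1) * 1 = 1 + 1 * q := by omega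
          rwa [h7, h8] at h6
      · intro l' hl'
        simp only [Finset.mem_erase, Finset.mem_range] at hl'
        omega
      · intro l' hl'
        have := hmul l'
        have := hlt l'
        have := hz l'
        simp only [Finset.mem_erase, Finset.mem_range]
        omega

end

end Interpolation

/-! ### The Dickson invariant of degree `p (p - 1)` -/

section DicksonInvariant

variable (R : Type*) [CommRing R] (p : ℕ)

/-- The Dickson invariant `∑ x^{(p - i)(p - 1)} y^{i (p - 1)}` of degree `p (p - 1)`. -/
def dicksonInv : MvPolynomial (Fin 2) R :=
  ∑ i ∈ Finset.range (p + 1), X 0 ^ ((p - i) * (p - 1)) * X 1 ^ (i * (p - 1))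

lemma dicksonInv_isHomogeneous : (dicksonInv R p).IsHomogeneous (p * (p - 1)) := by
  refine IsHomogeneous.sum _ _ _ fun i hi => ?_
  have h : (p - i) * (p - 1) + i * (p - 1) = p * (p - 1) := by
    rw [← add_mul, Nat.sub_add_cancel (by simpa [Nat.lt_succ_iff] using hi)]
  rw [← h]
  exact (isHomogeneous_X_pow _ _).mul (isHomogeneous_X_pow _ _)

lemma map_dicksonInv {R S : Type*} [CommRing R] [CommRing S] (σ : R →+* S) :
    MvPolynomial.map σ (dicksonInv R p) = dicksonInv S p := by
  simp [dicksonInv]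

/-- A geometric sum in `x^(p - 1)` and `y^(p - 1)`, using `p ^ 2 - 1 = (p - 1) (p + 1)`. -/
lemma dicksonInv_mul (hp : 1 ≤ p) : dicksonInv R p * (X 0 ^ p * X 1 - X 0 * X 1 ^ p) =
    X 0 ^ p ^ 2 * X 1 - X 0 * X 1 ^ p ^ 2 := by
  obtain ⟨q, rfl⟩ : ∃ q, p = q + 1 := ⟨p - 1, by omega⟩
  have h := (Commute.all (X 0 ^ q : MvPolynomial (Fin 2) R) (X 1 ^ q)).geom_sum₂_mul (q + 2)
  have h2 : dicksonInv R (q + 1) = ∑ i ∈ Finset.range (q + 2),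
      ((X 0 : MvPolynomial (Fin 2) R) ^ q) ^ i * (X 1 ^ q) ^ (q + 2 - 1 - i) := by
    rw [dicksonInv, ← Finset.sum_range_reflect]
    refine Finset.sum_congr rfl fun i hi => ?_
    have hi' : i ≤ q + 1 := by simpa [Nat.lt_succ_iff] using hi
    rw [← pow_mul, ← pow_mul, Nat.add_sub_cancel]
    congr 2
    · rw [mul_comm]
      congr 1
      omega
    · rw [mul_comm]
      congr 1
  rw [h2]
  have h3 : (X 0 ^ (q + 1) * X 1 - X 0 * X 1 ^ (q + 1) : MvPolynomial (Fin 2) R) =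
      (X 0 ^ q - X 1 ^ q) * (X 0 * X 1) := by ring
  rw [h3, ← mul_assoc, h, ← pow_mul, ← pow_mul]
  have h4 : (q + 1) ^ 2 = q * (q + 2) + 1 := by ring
  rw [h4]
  ring

lemma dickson_ne_zero (p : ℕ) [hp : Fact p.Prime] : dickson p ≠ 0 := by
  intro h
  have h1 := congrArg (coeff (Finsupp.single 0 p + Finsupp.single 1 1)) h
  have h2 : (X 0 ^ p * X 1 : MvPolynomial (Fin 2) (Fbar p)) =
      monomial (Finsupp.single 0 p + Finsupp.single 1 1) 1 := by
    rw [X_pow_eq_monomial, X, monomial_mul, mul_one]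
  have h3 : (X 0 * X 1 ^ p : MvPolynomial (Fin 2) (Fbar p)) =
      monomial (Finsupp.single 0 1 + Finsupp.single 1 p) 1 := by
    rw [X_pow_eq_monomial, X, monomial_mul, mul_one]
  have h4 : (Finsupp.single 0 1 + Finsupp.single 1 p : Fin 2 →₀ ℕ) ≠
      Finsupp.single 0 p + Finsupp.single 1 1 := by
    intro h
    have h5 := DFunLike.congr_fun h 0
    have := hp.out.one_lt
    simp at h5
    omega
  rw [dickson, coeff_sub, h2, h3, coeff_monomial, coeff_monomial, if_pos rfl, if_neg h4,
    coeff_zero, sub_zero] at h1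
  exact one_ne_zero h1

/-- Both `θ` and `x^(p²) y - x y^(p²)` are scaled by the determinant, so their quotient is
invariant. -/
lemma subst_dicksonInv_toFbar (p : ℕ) [hp : Fact p.Prime] (κ : K p) :
    subst (κ.1.map (toFbar p)) (dicksonInv (Fbar p) p) = dicksonInv (Fbar p) p := by
  have hC : ∀ i j, (C (toFbar p (κ.1 i j)) : MvPolynomial (Fin 2) (Fbar p)) ^ p =
      C (toFbar p (κ.1 i j)) := fun i j => by rw [← C_pow, toFbar_pow]
  have hE := dicksonInv_mul (Fbar p) p hp.out.one_le
  have hdet : toFbar p κ.1.det ≠ 0 := by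
    have : IsUnit κ.1.det := κ.det.isUnit
    exact (this.map (toFbar p)).ne_zero
  have hsub : subst (κ.1.map (toFbar p)) (X 0 ^ p ^ 2 * X 1 - X 0 * X 1 ^ p ^ 2) =
      C (toFbar p κ.1.det) * (X 0 ^ p ^ 2 * X 1 - X 0 * X 1 ^ p ^ 2) := by
    simp only [map_sub, map_mul, map_pow, subst_X, Fin.sum_univ_two, Matrix.map_apply,
      pow_two p, pow_mul, add_pow_char, mul_pow, hC, Matrix.det_fin_two]
    ring
  have h : subst (κ.1.map (toFbar p)) (dicksonInv (Fbar p) p) *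
      (C (toFbar p κ.1.det) * dickson p) =
      dicksonInv (Fbar p) p * (C (toFbar p κ.1.det) * dickson p) := by
    have hE' : dicksonInv (Fbar p) p * dickson p = X 0 ^ p ^ 2 * X 1 - X 0 * X 1 ^ p ^ 2 := hE
    rw [← subst_dickson, ← map_mul, hE', hsub, subst_dickson, ← hE']
    ring
  refine mul_right_cancel₀ (mul_ne_zero ?_ (dickson_ne_zero p)) h
  rwa [Ne, C_eq_zero]

lemma natCast_dvd_of_toFbar_eq_zero {p : ℕ} [Fact p.Prime] {x : ℤ_[p]} (hx : toFbar p x = 0) :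
    (p : ℤ_[p]) ∣ x := by
  have h : ¬ IsUnit x := fun h => (h.map (toFbar p)).ne_zero hx
  rw [← mem_nonunits_iff, ← IsLocalRing.mem_maximalIdeal, PadicInt.maximalIdeal_eq_span_p,
    Ideal.mem_span_singleton] at h
  exact h

/-- The congruence is proved over `ℤ_p`, where vanishing in the residue field means divisibility by
`p`. Over `ℤ̄_p` it would only give coefficients in the maximal ideal. -/
lemma natCast_dvd_subst_dicksonInv_sub {p : ℕ} [Fact p.Prime] (κ : K p) :
    (p : MvPolynomial (Fin 2) (Zbar p)) ∣
      subst (κ.1.map (toZbar p)) (dicksonInv (Zbar p) p) - dicksonInv (Zbar p) p := by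
  have h : (p : MvPolynomial (Fin 2) ℤ_[p]) ∣
      subst κ.1 (dicksonInv ℤ_[p] p) - dicksonInv ℤ_[p] p := by
    rw [← map_natCast (C : ℤ_[p] →+* _), C_dvd_iff_dvd_coeff]
    intro d
    apply natCast_dvd_of_toFbar_eq_zero
    rw [← coeff_map, map_sub, map_subst, map_dicksonInv, subst_dicksonInv_toFbar, sub_self,
      coeff_zero]
  have h2 := map_dvd (MvPolynomial.map (toZbar p)) h
  rwa [map_sub, map_subst, map_dicksonInv, map_natCast] at h2

end DicksonInvariant

/-! ### Congruences under the Hecke substitutions -/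

section HeckeSubst

/-- Each `p`-th power improves a congruence by a factor `p`. This turns congruences for `E` modulo
`p` into congruences for `E^N` modulo `p^t`. -/
lemma natCast_pow_dvd_pow_sub {p : ℕ} {R : Type*} [CommRing R] {x y : R} (h : (p : R) ∣ x - y) {t : ℕ}
    (ht : 1 ≤ t) (d : ℕ) : (p : R) ^ t ∣ x ^ (p ^ (t - 1) * d) - y ^ (p ^ (t - 1) * d) := by
  have h1 := dvd_sub_pow_of_dvd_sub h (t - 1)
  rw [Nat.sub_add_cancel ht] at h1
  rw [pow_mul, pow_mul]
  exact h1.trans (sub_dvd_pow_sub_pow _ _ _)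

variable {p : ℕ} [hp : Fact p.Prime]

lemma subst_heckeMat_some_X0 (l : ZMod p) : subst ((heckeMat p (some l))ᵀ.map (toZbar p)) (X 0) =
    (p : MvPolynomial (Fin 2) (Zbar p)) * X 0 + C (toZbar p (teich p l)) * X 1 := by
  simp [subst_X, heckeMat, Fin.sum_univ_two]

lemma subst_heckeMat_some_X1 (l : ZMod p) : subst ((heckeMat p (some l))ᵀ.map (toZbar p)) (X 1) =
    (X 1 : MvPolynomial (Fin 2) (Zbar p)) := by
  simp [subst_X, heckeMat, Fin.sum_univ_two]

lemma subst_heckeMat_none_X0 : subst ((heckeMat p none).map (toZbar p)) (X 0) =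
    (X 0 : MvPolynomial (Fin 2) (Zbar p)) := by
  simp [subst_X, heckeMat, Fin.sum_univ_two]

lemma subst_heckeMat_none_X1 : subst ((heckeMat p none).map (toZbar p)) (X 1) =
    (p : MvPolynomial (Fin 2) (Zbar p)) * X 1 := by
  simp [subst_X, heckeMat, Fin.sum_univ_two]

variable (p) in
/-- The Teichmüller character. -/
def teichHom : (ZMod p)ˣ →* Zbar p where
  toFun l := toZbar p (teich p l)
  map_one' := by simp [teich]
  map_mul' l m := by simp [teich]

lemma teich_zero : teich p 0 = 0 := by simp [teich]

lemma toZbar_injective : Function.Injective (toZbar p) := by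
  intro x y h
  have h1 := congrArg (algebraMap (Zbar p) (Qbar p)) h
  have h2 : toQbar p x = toQbar p y := h1
  exact Subtype.ext ((algebraMap ℚ_[p] (PadicAlgCl p)).injective h2)

lemma teichHom_injective : Function.Injective (teichHom p) := by
  intro l m h
  obtain ⟨e, he, hel⟩ := exists_teich_residue p
  have h1 : teich p (l : ZMod p) = teich p (m : ZMod p) := toZbar_injective h
  have h2 := (hel l (teich p (l : ZMod p))).1 ⟨0, by simp⟩
  have h3 := (hel m (teich p (m : ZMod p))).1 ⟨0, by simp⟩
  exact Units.ext (he.1 (h2.symm.trans ((congrArg _ h1).trans h3)))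

lemma teich_pow_sub_one {l : ZMod p} (hl : l ≠ 0) : toZbar p (teich p l) ^ (p - 1) = 1 := by
  have h : teichHom p (Units.mk0 l hl ^ (p - 1)) = 1 := by
    rw [ZMod.units_pow_card_sub_one_eq_one, map_one]
  rwa [map_pow] at h

lemma natCast_dvd_subst_heckeMat_some_X0_pow_sub {l : ZMod p} (hl : l ≠ 0) :
    (p : MvPolynomial (Fin 2) (Zbar p)) ∣
      subst ((heckeMat p (some l))ᵀ.map (toZbar p)) (X 0) ^ (p - 1) - X 1 ^ (p - 1) := by
  have h : (X 1 ^ (p - 1) : MvPolynomial (Fin 2) (Zbar p)) =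
      (C (toZbar p (teich p l)) * X 1) ^ (p - 1) := by
    rw [mul_pow, ← C_pow, teich_pow_sub_one hl, C_1, one_mul]
  rw [h, subst_heckeMat_some_X0]
  refine dvd_trans ?_ (sub_dvd_pow_sub_pow _ _ _)
  rw [add_sub_cancel_right]
  exact dvd_mul_right _ _

/-- Each of the `p + 1` terms of `E` becomes `y^(p (p - 1))` modulo `p`, and `p + 1` is congruent to
`1`. -/
lemma natCast_dvd_subst_heckeMat_some_dicksonInv {l : ZMod p} (hl : l ≠ 0) :
    (p : MvPolynomial (Fin 2) (Zbar p)) ∣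
      subst ((heckeMat p (some l))ᵀ.map (toZbar p)) (dicksonInv _ p) - X 1 ^ (p * (p - 1)) := by
  have h1 : (X 1 ^ (p * (p - 1)) : MvPolynomial (Fin 2) (Zbar p)) =
      ∑ i ∈ Finset.range (p + 1), X 1 ^ ((p - i) * (p - 1)) * X 1 ^ (i * (p - 1)) -
        (p : MvPolynomial (Fin 2) (Zbar p)) * X 1 ^ (p * (p - 1)) := by
    have h2 : ∀ i ∈ Finset.range (p + 1), (X 1 ^ ((p - i) * (p - 1)) * X 1 ^ (i * (p - 1)) :
        MvPolynomial (Fin 2) (Zbar p)) = X 1 ^ (p * (p - 1)) := by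
      intro i hi
      rw [← pow_add, ← add_mul, Nat.sub_add_cancel (by simpa [Nat.lt_succ_iff] using hi)]
    rw [Finset.sum_congr rfl h2, Finset.sum_const, Finset.card_range, nsmul_eq_mul]
    push_cast
    ring
  rw [h1, ← sub_add, dicksonInv, map_sum, ← Finset.sum_sub_distrib]
  refine dvd_add (Finset.dvd_sum fun i _ => ?_) (dvd_mul_right _ _)
  rw [map_mul, map_pow, map_pow, subst_heckeMat_some_X1, ← sub_mul, mul_comm (p - i), pow_mul,
    pow_mul]
  exact ((natCast_dvd_subst_heckeMat_some_X0_pow_sub hl).trans (sub_dvd_pow_sub_pow _ _ _)).mul_right _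

lemma natCast_dvd_subst_heckeMat_none_dicksonInv :
    (p : MvPolynomial (Fin 2) (Zbar p)) ∣
      subst ((heckeMat p none).map (toZbar p)) (dicksonInv _ p) - X 0 ^ (p * (p - 1)) := by
  rw [dicksonInv, map_sum, Finset.sum_range_succ']
  simp only [zero_mul, pow_zero, mul_one, Nat.sub_zero, map_pow, map_mul, subst_heckeMat_none_X0,
    subst_heckeMat_none_X1, add_sub_cancel_right, mul_pow]
  refine Finset.dvd_sum fun i _ => Dvd.dvd.mul_left (Dvd.dvd.mul_right (dvd_pow_self _ ?_) _) _
  have := hp.out.two_le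
  exact Nat.mul_ne_zero (by omega) (by omega)

end HeckeSubst

/-! ### The monomial basis of symmetric powers -/

section Monomials

variable (R : Type*) [CommRing R]

/-- The monomial `x^{s - e} y^e` for `e ≤ s`. -/
def mono (s e : ℕ) : SymPow R s :=
  -- The truncation `min e s` keeps the degree equal to `s` for every `e`.
  SymPow.mk (X 0 ^ (s - e) * X 1 ^ min e s) (by
    have h := (isHomogeneous_X_pow (R := R) (0 : Fin 2) (s - e)).mul
      (isHomogeneous_X_pow (R := R) (1 : Fin 2) (min e s))
    rwa [show s - e + min e s = s by omega] at h)

lemma mono_poly {s e : ℕ} (he : e ≤ s) :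
    (mono R s e).poly = X 0 ^ (s - e) * X 1 ^ e := by
  rw [mono, SymPow.poly_mk, min_eq_left he]

variable {R} {n s r : ℕ}

/-- Multiplication by a homogeneous polynomial. -/
def mulSym (h : MvPolynomial (Fin 2) R) (hh : h.IsHomogeneous n) (hr : n + s = r) :
    SymPow R s →ₗ[R] SymPow R r where
  toFun f := SymPow.mk (h * f.poly) (hr ▸ hh.mul f.isHomogeneous)
  map_add' f g := by ext1; simp [mul_add]
  map_smul' c f := by ext1; simp

@[simp] lemma mulSym_poly (h : MvPolynomial (Fin 2) R) (hh : h.IsHomogeneous n) (hr : n + s = r)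
    (f : SymPow R s) : (mulSym h hh hr f).poly = h * f.poly := rfl

lemma symMap_mulSym {S : Type*} [CommRing S] (σ : R →+* S) (h : MvPolynomial (Fin 2) R)
    (hh : h.IsHomogeneous n) (hr : n + s = r) (f : SymPow R s) :
    symMap σ r (mulSym h hh hr f) =
      mulSym (MvPolynomial.map σ h) (hh.map σ) hr (symMap σ s f) := by
  ext1
  simp

lemma sum_mono (f : SymPow R s) : ∃ c : ℕ → R, f = ∑ e ∈ Finset.range (s + 1), c e • mono R s e := by
  have hd : ∀ d ∈ f.poly.support, d 0 + d 1 = s := by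
    intro d hd
    have h := f.isHomogeneous (mem_support_iff.1 hd)
    rwa [Finsupp.weight_apply, Finsupp.sum_fintype _ _ (by simp), Fin.sum_univ_two, Pi.one_apply,
      Pi.one_apply, smul_eq_mul, smul_eq_mul, mul_one, mul_one] at h
  refine ⟨fun e => coeff (Finsupp.single 0 (s - e) + Finsupp.single 1 e) f.poly, ?_⟩
  have hmon : ∀ i j : ℕ, (X 0 ^ i * X 1 ^ j : MvPolynomial (Fin 2) R) =
      monomial (Finsupp.single 0 i + Finsupp.single 1 j) 1 := by
    intro i j
    rw [X_pow_eq_monomial, X_pow_eq_monomial, monomial_mul, mul_one]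
  ext1
  rw [map_sum]
  ext d
  rw [coeff_sum]
  simp only [map_smul, coeff_smul, smul_eq_mul]
  by_cases hds : d 0 + d 1 = s
  · rw [Finset.sum_eq_single (d 1)]
    · have h1 : Finsupp.single 0 (s - d 1) + Finsupp.single 1 (d 1) = d := by
        ext i
        fin_cases i
        · simp
          omega
        · simp
      rw [mono_poly R (by omega), hmon, h1, coeff_monomial, if_pos rfl, mul_one]
    · intro e he hne
      rw [mono_poly R (by simpa [Nat.lt_succ_iff] using he), hmon, coeff_monomial, if_neg, mul_zero]
      intro h
      apply hne
      rw [← h]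
      simp
    · intro h
      exact absurd (Finset.mem_range.2 (by omega)) h
  · have h0 : coeff d f.poly = 0 := by
      by_contra h
      exact hds (hd d (mem_support_iff.2 h))
    rw [h0, eq_comm]
    refine Finset.sum_eq_zero fun e he => ?_
    rw [mono_poly R (by simpa [Nat.lt_succ_iff] using he), hmon, coeff_monomial, if_neg, mul_zero]
    rintro rfl
    apply hds
    have : e ≤ s := by simpa [Nat.lt_succ_iff] using he
    simp
    omega

end Monomials

/-! ### Passing from weight `s` to weight `r` -/

section Shift

variable {p r s t d : ℕ}

variable (p t d) in
/-- The power of the Dickson invariant by which weights are shifted. -/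
def shift (R : Type*) [CommRing R] : MvPolynomial (Fin 2) R := dicksonInv R p ^ (p ^ (t - 1) * d)

lemma shift_isHomogeneous (R : Type*) [CommRing R] (ht : 1 ≤ t) :
    (shift p t d R).IsHomogeneous (p ^ t * (p - 1) * d) := by
  have h := (dicksonInv_isHomogeneous R p).pow (p ^ (t - 1) * d)
  have h2 : p * (p - 1) * (p ^ (t - 1) * d) = p ^ t * (p - 1) * d := by
    obtain ⟨t, rfl⟩ : ∃ t', t = t' + 1 := ⟨t - 1, by omega⟩
    rw [Nat.add_sub_cancel, pow_succ]
    ring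
  rwa [h2] at h

lemma map_shift {R S : Type*} [CommRing R] [CommRing S] (σ : R →+* S) :
    MvPolynomial.map σ (shift p t d R) = shift p t d S := by
  rw [shift, map_pow, map_dicksonInv, shift]

lemma shift_pow_exponent {R : Type*} [CommRing R] (x : R) (ht : 1 ≤ t) :
    (x ^ (p * (p - 1))) ^ (p ^ (t - 1) * d) = x ^ (p ^ t * (p - 1) * d) := by
  rw [← pow_mul]
  congr 1
  obtain ⟨t, rfl⟩ : ∃ t', t = t' + 1 := ⟨t - 1, by omega⟩
  rw [Nat.add_sub_cancel, pow_succ]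
  ring

/-- Multiplication by `shift`, as a map `Sym^s → Sym^r` for `r = s + p^t (p - 1) d`. -/
def shiftSym (R : Type*) [CommRing R] (ht : 1 ≤ t) (hr : r = s + p ^ t * (p - 1) * d) :
    SymPow R s →ₗ[R] SymPow R r :=
  mulSym (shift p t d R) (shift_isHomogeneous R ht) (by rw [hr, add_comm])

lemma symMap_shiftSym {R S : Type*} [CommRing R] [CommRing S] (σ : R →+* S) (ht : 1 ≤ t)
    (hr : r = s + p ^ t * (p - 1) * d) (f : SymPow R s) :
    symMap σ r (shiftSym R ht hr f) = shiftSym S ht hr (symMap σ s f) := by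
  rw [shiftSym, symMap_mulSym]
  ext1
  rw [mulSym_poly, map_shift]
  rfl

end Shift

/-! ### Negligible monomials at the ends of the range -/

section NegligibleMonomials

variable {p : ℕ} [hp : Fact p.Prime] {r s c t d : ℕ} {a : Qbar p}

lemma smul_incl_mem_negl_congr {x : Qbar p} {n : ℕ} {f g : SymPow (Zbar p) r}
    (hfg : (p : MvPolynomial (Fin 2) (Zbar p)) ^ n ∣ f.poly - g.poly)
    (hx : ‖x‖ * (p : ℝ)⁻¹ ^ n < 1) (hf : x • incl p r f ∈ negl p r a) :
    x • incl p r g ∈ negl p r a := by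
  have h := smul_incl_mem_negl_of_dvd (a := a) (f := f - g) (x := x) (n := n)
    (by rwa [map_sub]) hx
  have h2 := sub_mem hf h
  rwa [map_sub, smul_sub, sub_sub_cancel] at h2

lemma incl_pow_smul (j : ℕ) (f : SymPow (Zbar p) r) :
    incl p r ((p : Zbar p) ^ j • f) = (p : Qbar p) ^ j • incl p r f := by
  rw [LinearMap.map_smulₛₗ, map_pow, map_natCast]

lemma norm_inv_pow_mul_lt_one {n : ℕ} (hcn : c < n) :
    ‖((p : Qbar p) ^ c)⁻¹‖ * (p : ℝ)⁻¹ ^ n < 1 := by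
  have hp1 : (1 : ℝ) < p := by exact_mod_cast hp.out.one_lt
  rw [norm_inv, norm_pow, norm_natCast_p, inv_mul_lt_iff₀ (by positivity), mul_one]
  exact pow_lt_pow_right_of_lt_one₀ (by positivity) (inv_lt_one_of_one_lt₀ hp1) hcn

/-- Apply the second source to `p^(-c) y^j (x^(p - 1) - y^(p - 1))^(c + 1) x^N`. The matrix `(1, 0;
0, p)` turns it into `p^(j - c) x^(r - j) y^j` up to an error divisible by `p`, as `p - 1 ≥ c + 1`.
Under the other matrices `p^(c + 1)` comes from `x^N` if `l = 0` and from the middle factor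
otherwise. -/
lemma smul_incl_mono_mem_negl (hca : ‖a‖ < (p : ℝ)⁻¹ ^ c) (hc : c + 1 < p)
    {j : ℕ} (hj : j ≤ c) (hr : j + (c + 1) * (p - 1) + (c + 1) ≤ r) :
    ((p : Qbar p) ^ j * ((p : Qbar p) ^ c)⁻¹) • incl p r (mono _ r j) ∈ negl p r a := by
  obtain ⟨N, hN⟩ : ∃ N, r = j + (c + 1) * (p - 1) + N := ⟨_, (Nat.add_sub_of_le (by omega)).symm⟩
  have hhom : (X 1 ^ j * (X 0 ^ (p - 1) - X 1 ^ (p - 1)) ^ (c + 1) * X 0 ^ N :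
      MvPolynomial (Fin 2) (Zbar p)).IsHomogeneous r := by
    rw [hN, mul_comm (c + 1)]
    exact (((isHomogeneous_X_pow _ _).mul
      (((isHomogeneous_X_pow _ _).sub (isHomogeneous_X_pow _ _)).pow _)).mul
      (isHomogeneous_X_pow _ _))
  have h := smul_incl_symEnd_mem_negl (a := a) (x := ((p : Qbar p) ^ c)⁻¹) (n := c + 1)
    (f := SymPow.mk _ hhom) ?_ (norm_inv_pow_mul_lt_one (Nat.lt_succ_self c)) ?_
  · have h2 := smul_incl_mem_negl_congr (n := c + 1) (g := (p : Zbar p) ^ j • mono _ r j) ?_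
      (norm_inv_pow_mul_lt_one (Nat.lt_succ_self c)) h
    · rwa [incl_pow_smul, smul_smul, mul_comm] at h2
    · rw [symEnd_apply, map_smul, SymPow.poly_mk, mono_poly _ (by omega), smul_eq_C_mul, map_pow,
        map_natCast]
      simp only [map_mul, map_pow, map_sub, subst_heckeMat_none_X0, subst_heckeMat_none_X1]
      have h3 : r - j = (p - 1) * (c + 1) + N := by
        rw [hN, mul_comm (c + 1)]
        omega
      have h4 : ((p : MvPolynomial (Fin 2) (Zbar p)) * X 1) ^ j *
          (X 0 ^ (p - 1) - ((p : MvPolynomial (Fin 2) (Zbar p)) * X 1) ^ (p - 1)) ^ (c + 1) * X 0 ^ N -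
          (p : MvPolynomial (Fin 2) (Zbar p)) ^ j * (X 0 ^ (r - j) * X 1 ^ j) =
          (p : MvPolynomial (Fin 2) (Zbar p)) ^ j * X 1 ^ j * X 0 ^ N *
          ((X 0 ^ (p - 1) - ((p : MvPolynomial (Fin 2) (Zbar p)) * X 1) ^ (p - 1)) ^ (c + 1) - (X 0 ^ (p - 1)) ^ (c + 1)) := by
        rw [h3, pow_add _ _ N, pow_mul _ (p - 1) (c + 1)]
        ring
      rw [h4]
      refine Dvd.dvd.mul_left (dvd_trans ?_ (sub_dvd_pow_sub_pow _ _ _)) _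
      rw [dvd_sub_comm, sub_sub_cancel, mul_pow]
      exact (pow_dvd_pow _ (by omega)).mul_right _
  · intro l
    rw [SymPow.poly_mk]
    simp only [map_mul, map_pow, map_sub]
    by_cases hl : l = 0
    · subst hl
      refine Dvd.dvd.mul_left ?_ _
      rw [subst_heckeMat_some_X0, teich_zero, map_zero, C_0, zero_mul, add_zero, mul_pow]
      exact (pow_dvd_pow _ (by omega)).mul_right _
    · refine (Dvd.dvd.mul_left ?_ _).mul_right _
      rw [subst_heckeMat_some_X1]
      exact pow_dvd_pow_of_dvd (natCast_dvd_subst_heckeMat_some_X0_pow_sub hl) _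
  · have hp1 : (0 : ℝ) < p := by exact_mod_cast hp.out.pos
    rwa [norm_inv, norm_pow, norm_natCast_p, mul_inv_lt_iff₀ (by positivity), one_mul]

/-- By the first source it is enough that every Hecke substitution makes `p^j x^(s - j) y^j (x^(r -
s) - E^N)` divisible by `p^n`. Where `x` does not become a multiple of `p`, both terms of the last
factor have the same image modulo `p^t`. -/
lemma smul_incl_shift_mono_mem_negl (ha : a ≠ 0) (hca : ‖a‖ < (p : ℝ)⁻¹ ^ c) (hc : c + 1 < p)
    (ht : 1 ≤ t) (hr : r = s + p ^ t * (p - 1) * d) (hcs : c ≤ s)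
    (hr' : c + (c + 1) * (p - 1) + (c + 1) ≤ r) {n : ℕ} (hnt : n ≤ t) (hns : n ≤ s)
    (hna : ‖((p : Qbar p) ^ c)⁻¹‖ * (p : ℝ)⁻¹ ^ n < ‖a‖) {j : ℕ} (hj : j ≤ c) :
    ((p : Qbar p) ^ j * ((p : Qbar p) ^ c)⁻¹) • incl p r (shiftSym _ ht hr (mono _ s j)) ∈
      negl p r a := by
  have h1 := smul_incl_mono_mem_negl (r := r) hca hc hj (by omega)
  have h2 := smul_incl_mem_negl_of_heckeMat ha (x := ((p : Qbar p) ^ c)⁻¹) (n := n)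
    (f := (p : Zbar p) ^ j • (mono _ r j - shiftSym _ ht hr (mono _ s j))) ?_ hna
  · rw [incl_pow_smul, smul_smul, mul_comm _ ((p : Qbar p) ^ j), map_sub, smul_sub] at h2
    have h3 := sub_mem h1 h2
    rwa [sub_sub_cancel] at h3
  · have hpoly : SymPow.poly ((p : Zbar p) ^ j •
        (mono (Zbar p) r j - shiftSym (Zbar p) ht hr (mono _ s j))) =
        (p : MvPolynomial (Fin 2) (Zbar p)) ^ j * (X 0 ^ (s - j) * X 1 ^ j *
          (X 0 ^ (p ^ t * (p - 1) * d) - shift p t d _)) := by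
      rw [map_smul, map_sub, smul_eq_C_mul, map_pow, map_natCast, mono_poly _ (by omega), shiftSym,
        mulSym_poly, mono_poly _ (by omega)]
      have : r - j = (s - j) + p ^ t * (p - 1) * d := by omega
      rw [this, pow_add]
      ring
    have hpn : (p : MvPolynomial (Fin 2) (Zbar p)) ^ n ∣ p ^ t := pow_dvd_pow _ hnt
    have hpd : ∀ x y : MvPolynomial (Fin 2) (Zbar p), (p : MvPolynomial (Fin 2) (Zbar p)) ∣ x - y →
        (p : MvPolynomial (Fin 2) (Zbar p)) ^ n ∣
          x ^ (p ^ (t - 1) * d) - y ^ (p ^ (t - 1) * d) :=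
      fun x y h => hpn.trans (natCast_pow_dvd_pow_sub h ht d)
    intro i
    rw [hpoly]
    simp only [map_mul, map_pow, map_sub, map_natCast]
    cases i with
    | none =>
      refine Dvd.dvd.mul_left (Dvd.dvd.mul_left ?_ _) _
      rw [transpose_heckeMat_none, subst_heckeMat_none_X0, shift, map_pow, ← shift_pow_exponent _ ht,
        dvd_sub_comm]
      exact hpd _ _ natCast_dvd_subst_heckeMat_none_dicksonInv
    | some l =>
      by_cases hl : l = 0
      -- For `l = 0` the substitution `x ↦ p x` contributes `p^(s - j)`, and the scalar `p^j`
      -- completes it to `p^s`.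
      · subst hl
        rw [subst_heckeMat_some_X0, teich_zero, map_zero, C_0, zero_mul, add_zero, mul_pow,
          mul_assoc, mul_assoc, ← mul_assoc (_ ^ j), ← pow_add]
        exact (pow_dvd_pow _ (by omega)).mul_right _
      · refine Dvd.dvd.mul_left (Dvd.dvd.mul_left ?_ _) _
        have h3 := hpd _ _ (natCast_dvd_subst_heckeMat_some_dicksonInv hl)
        have h4 := hpd _ _ ((natCast_dvd_subst_heckeMat_some_X0_pow_sub hl).trans
          (sub_dvd_pow_sub_pow _ _ p))
        have h5 : ∀ x : MvPolynomial (Fin 2) (Zbar p), (x ^ (p - 1)) ^ p = x ^ (p * (p - 1)) :=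
          fun x => by rw [← pow_mul, mul_comm]
        rw [h5, h5, shift_pow_exponent _ ht] at h4
        rw [shift, map_pow]
        have h6 := dvd_sub h4 h3
        rwa [sub_sub_sub_cancel_right] at h6

/-- `E^N` is `K`-invariant only modulo `p^t`; since `c < t`, the discrepancy stays small after
division by `p^c`. -/
lemma smul_incl_shift_symEnd_mem_negl (ht : 1 ≤ t) (hr : r = s + p ^ t * (p - 1) * d)
    (hct : c < t) (κ : K p) {j : ℕ} {f : SymPow (Zbar p) s}
    (h : ((p : Qbar p) ^ j * ((p : Qbar p) ^ c)⁻¹) • incl p r (shiftSym _ ht hr f) ∈ negl p r a) :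
    ((p : Qbar p) ^ j * ((p : Qbar p) ^ c)⁻¹) •
      incl p r (shiftSym _ ht hr (symEnd s (κ.1.map (toZbar p)) f)) ∈ negl p r a := by
  have h1 := negl_symRep κ h
  rw [map_smul, symRep_apply, symEnd_incl] at h1
  refine smul_incl_mem_negl_congr (n := t) ?_ ?_ h1
  · rw [symEnd_apply, shiftSym, mulSym_poly, mulSym_poly, symEnd_apply, map_mul, ← sub_mul, shift,
      map_pow]
    exact (natCast_pow_dvd_pow_sub (natCast_dvd_subst_dicksonInv_sub κ) ht d).mul_right _
  · refine lt_of_le_of_lt ?_ (norm_inv_pow_mul_lt_one (p := p) hct)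
    rw [norm_mul, mul_assoc]
    refine mul_le_of_le_one_left (by positivity) ?_
    have hp1 : (1 : ℝ) ≤ p := by exact_mod_cast hp.out.one_le
    rw [norm_pow, norm_natCast_p]
    exact pow_le_one₀ (by positivity) (inv_le_one_of_one_le₀ hp1)

end NegligibleMonomials

/-! ### Torus averages and negligibility of all of `E^N Sym^s` -/

section Generation

variable {p : ℕ} [hp : Fact p.Prime] {r s b c t d : ℕ} {a : Qbar p}

lemma exists_mul_intCast_eq_one {n : ℤ} (hn : ¬ (p : ℤ) ∣ n) : ∃ z : Zbar p, z * n = 1 := by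
  have h1 : ‖(n : ℚ_[p])‖ = 1 := by
    refine le_antisymm (Padic.norm_int_le_one n) (not_lt.1 fun h => hn ?_)
    exact Padic.norm_intCast_lt_one_iff.1 h
  have h2 : ‖(n : Qbar p)‖ = 1 := by
    have := PadicAlgCl.norm_extends p (n : ℚ_[p])
    rw [h1] at this
    rwa [map_intCast] at this
  obtain ⟨z, hz⟩ := exists_eq_algebraMap (x := ((n : Qbar p))⁻¹) (by rw [norm_inv, h2, inv_one])
  refine ⟨z, Subtype.val_injective ?_⟩
  have h3 : (n : Qbar p) ≠ 0 := by
    intro h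
    rw [h, norm_zero] at h2
    exact zero_ne_one h2
  have h4 : algebraMap (Zbar p) (Qbar p) (z * n) = 1 := by
    rw [map_mul, hz, map_intCast, inv_mul_cancel₀ h3]
  exact h4

/-- Orthogonality of characters of the cyclic group `𝔽_p^×`, on which the Teichmüller character is
faithful. -/
lemma sum_teichHom (e k : ℕ) : ∑ l : (ZMod p)ˣ, teichHom p l⁻¹ ^ k * teichHom p l ^ e =
    if e % (p - 1) = k % (p - 1) then ((p - 1 : ℕ) : Zbar p) else 0 := by
  classical
  let ψ : (ZMod p)ˣ →* Zbar p :=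
    { toFun := fun l => teichHom p l⁻¹ ^ k * teichHom p l ^ e
      map_one' := by simp
      map_mul' := fun l m => by
        simp only [mul_inv, map_mul, mul_pow]
        ring }
  have h := sum_hom_units ψ
  have hψ : ψ = 1 ↔ e % (p - 1) = k % (p - 1) := by
    have h1 : ∀ l, ψ l = 1 ↔ l ^ e = l ^ k := by
      intro l
      have h2 : ψ l = teichHom p ((l ^ k)⁻¹ * l ^ e) := by
        change teichHom p l⁻¹ ^ k * teichHom p l ^ e = _
        rw [← inv_pow, map_mul, map_pow, map_pow]
      rw [h2, ← map_one (teichHom p), teichHom_injective.eq_iff, inv_mul_eq_one, eq_comm]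
    constructor
    · intro h2
      obtain ⟨g, hg⟩ := IsCyclic.exists_generator (α := (ZMod p)ˣ)
      have h3 := (h1 g).1 (by rw [h2]; rfl)
      have h4 := pow_eq_pow_iff_modEq.1 h3
      rw [orderOf_eq_card_of_forall_mem_zpowers hg, Nat.card_eq_fintype_card,
        ZMod.card_units] at h4
      exact h4
    · intro h2
      ext1 l
      refine (h1 l).2 (pow_eq_pow_iff_modEq.2 (Nat.ModEq.of_dvd ?_ h2))
      rw [← ZMod.card_units p]
      exact orderOf_dvd_card
  rw [ZMod.card_units, if_congr hψ rfl rfl] at h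
  rw [← Nat.cast_zero, ← apply_ite Nat.cast]
  exact h

/-- The lower unipotent matrix `(1, 0; [l], 1)`. -/
def lowerUnipotent (l : (ZMod p)ˣ) : K p :=
  Matrix.GeneralLinearGroup.mk'' !![1, 0; teich p l, 1] (by simp [Matrix.det_fin_two_of])

/-- The matrix `(0, 1; 1, 0)`. -/
def weyl : K p := Matrix.GeneralLinearGroup.mk'' !![0, 1; 1, 0] (by simp [Matrix.det_fin_two_of])

lemma symEnd_weyl_mono {j : ℕ} (hj : j ≤ s) :
    symEnd s ((weyl (p := p)).1.map (toZbar p)) (mono _ s j) = mono _ s (s - j) := by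
  ext1
  rw [symEnd_apply, mono_poly _ hj, mono_poly _ (Nat.sub_le _ _), map_mul, map_pow, map_pow,
    subst_X, subst_X, Nat.sub_sub_self hj]
  simp [weyl, Fin.sum_univ_two]
  ring

lemma symEnd_lowerUnipotent_mono (l : (ZMod p)ˣ) {j : ℕ} (hj : j ≤ s) :
    symEnd s ((lowerUnipotent l).1.map (toZbar p)) (mono _ s j) =
      ∑ e ∈ Finset.Ico j (s + 1),
        (teichHom p l ^ (e - j) * (s - j).choose (e - j)) • mono _ s e := by
  ext1
  rw [symEnd_apply, mono_poly _ hj, map_mul, map_pow, map_pow, subst_X, subst_X, map_sum,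
    Finset.sum_Ico_eq_sum_range]
  have h0 : ∑ i, C ((lowerUnipotent l).1.map (toZbar p) i 0) * X i =
      C (teichHom p l) * X 1 + (X 0 : MvPolynomial (Fin 2) (Zbar p)) := by
    have h : teichHom p l = toZbar p (teich p l) := rfl
    simp only [lowerUnipotent, h, Fin.sum_univ_two, Matrix.GeneralLinearGroup.val_mk'',
      Matrix.map_apply, Matrix.of_apply, Matrix.cons_val', Matrix.cons_val_zero,
      Matrix.cons_val_one, Matrix.cons_val_fin_one, map_one, one_mul]
    ring
  have h1 : ∑ i, C ((lowerUnipotent l).1.map (toZbar p) i 1) * X i =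
      (X 1 : MvPolynomial (Fin 2) (Zbar p)) := by
    simp [lowerUnipotent, Fin.sum_univ_two]
  rw [h0, h1, add_pow, Finset.sum_mul, Nat.sub_add_comm hj]
  refine Finset.sum_congr rfl fun i hi => ?_
  have hi' : i ≤ s - j := by simpa [Nat.lt_succ_iff] using hi
  rw [map_smul, mono_poly _ (by omega), smul_eq_C_mul, Nat.add_sub_cancel_left, map_mul, map_pow,
    map_natCast, mul_pow, pow_add, Nat.sub_sub]
  ring

/-- The weights turn the coefficient `[l]^(e - j)` into `[l]^(e - k)`, so summing over `l` selects
the class of `k`. -/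
lemma sum_symEnd_lowerUnipotent {j : ℕ} (hj : j ≤ s) (k : ℕ) :
    ∑ l : (ZMod p)ˣ, (teichHom p l ^ j * teichHom p l⁻¹ ^ k) •
      symEnd s ((lowerUnipotent l).1.map (toZbar p)) (mono _ s j) =
    (p - 1) • ∑ e ∈ residueClass (p - 1) s k with j ≤ e, (s - j).choose (e - j) • mono (Zbar p) s e := by
  simp_rw [symEnd_lowerUnipotent_mono _ hj, Finset.smul_sum, smul_smul]
  rw [Finset.sum_comm]
  have h1 : {e ∈ residueClass (p - 1) s k | j ≤ e} =
      {e ∈ Finset.Ico j (s + 1) | e % (p - 1) = k % (p - 1)} := by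
    ext e
    simp only [residueClass, Finset.mem_filter, Finset.mem_range, Finset.mem_Ico]
    tauto
  rw [h1, Finset.sum_filter]
  refine Finset.sum_congr rfl fun e he => ?_
  rw [← Finset.sum_smul]
  have h2 : ∀ l : (ZMod p)ˣ, teichHom p l ^ j * teichHom p l⁻¹ ^ k *
      (teichHom p l ^ (e - j) * ((s - j).choose (e - j) : Zbar p)) =
      (teichHom p l⁻¹ ^ k * teichHom p l ^ e) * ((s - j).choose (e - j) : Zbar p) := by
    intro l
    have h3 : e = j + (e - j) := by
      have := (Finset.mem_Ico.1 he).1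
      omega
    conv_rhs => rw [h3, pow_add]
    rw [← h3]
    ring
  rw [Finset.sum_congr rfl fun l _ => h2 l, ← Finset.sum_mul, sum_teichHom]
  split_ifs
  · rw [← Nat.cast_mul, Nat.cast_smul_eq_nsmul]
  · rw [zero_mul, zero_smul]

lemma smul_incl_smul (x : Qbar p) (z : Zbar p) (f : SymPow (Zbar p) r) :
    x • incl p r (z • f) = z • x • incl p r f := by
  rw [LinearMap.map_smulₛₗ, smul_comm, ← algebraMap_smul_sym]

/-- The inputs of the interpolation are the base monomials, their images under `weyl`, and the
averages of their translates under `lowerUnipotent`. -/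
theorem incl_shiftSym_mem_negl (ha : a ≠ 0) (hca : ‖a‖ < (p : ℝ)⁻¹ ^ c) (hc1 : 1 ≤ c)
    (hc : c + 1 < p) (hb : 2 ≤ b) (hbp : b ≤ p) (hs : s = b + c * (p - 1)) (ht : 1 ≤ t)
    (hr : r = s + p ^ t * (p - 1) * d) (hct : c < t)
    (hr' : c + (c + 1) * (p - 1) + (c + 1) ≤ r) {n : ℕ} (hnt : n ≤ t) (hns : n ≤ s)
    (hna : ‖((p : Qbar p) ^ c)⁻¹‖ * (p : ℝ)⁻¹ ^ n < ‖a‖) (f : SymPow (Zbar p) s) :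
    incl p r (shiftSym _ ht hr f) ∈ negl p r a := by
  have hcs : c ≤ s := by
    have : c * 1 ≤ c * (p - 1) := Nat.mul_le_mul_left c (by omega)
    omega
  have hpF : (p : Qbar p) ≠ 0 := by exact_mod_cast hp.out.ne_zero
  have hbase := fun {j} (hj : j ≤ c) =>
    smul_incl_shift_mono_mem_negl ha hca hc ht hr hcs hr' hnt hns hna hj
  have hmono : ∀ e ≤ s, incl p r (shiftSym _ ht hr (mono _ s e)) ∈ (negl p r a).toAddSubgroup := by
    refine forall_mem_of_interpolation (F := Qbar p) (negl p r a).toAddSubgroup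
      (fun e => incl p r (shiftSym _ ht hr (mono _ s e))) hpF ?_ ?_ ?_ ?_ hc1 hc hb hbp hs
    · intro m v hm hv
      obtain ⟨z, hz⟩ := exists_mul_intCast_eq_one hm
      have h1 := (negl p r a).smul_mem z hv
      rwa [← Int.cast_smul_eq_zsmul (Zbar p), smul_smul, hz, one_smul] at h1
    · exact fun j hj => hbase hj
    · intro j hj
      have h1 := smul_incl_shift_symEnd_mem_negl ht hr hct weyl (hbase hj)
      rwa [symEnd_weyl_mono (hj.trans hcs)] at h1
    · intro j hj k
      have h1 : ∀ l : (ZMod p)ˣ, ((p : Qbar p) ^ j * ((p : Qbar p) ^ c)⁻¹) • incl p r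
          (shiftSym _ ht hr ((teichHom p l ^ j * teichHom p l⁻¹ ^ k) •
            symEnd s ((lowerUnipotent l).1.map (toZbar p)) (mono _ s j))) ∈ negl p r a := by
        intro l
        have h2 := smul_incl_shift_symEnd_mem_negl ht hr hct (lowerUnipotent l) (hbase hj)
        rw [map_smul, smul_incl_smul]
        exact (negl p r a).smul_mem _ h2
      have h2 := sum_mem fun l (_ : l ∈ Finset.univ) => h1 l
      rw [← Finset.smul_sum, ← map_sum, ← map_sum, sum_symEnd_lowerUnipotent (hj.trans hcs)] at h2
      -- The average carries the factor `p - 1`, which is a unit in `ℤ̄_p`.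
      have hp1 : ¬ (p : ℤ) ∣ ((p - 1 : ℕ) : ℤ) := by
        rw [Int.natCast_dvd_natCast]
        exact fun h => absurd (Nat.le_of_dvd (by omega) h) (by omega)
      obtain ⟨z, hz⟩ := exists_mul_intCast_eq_one hp1
      have h3 := (negl p r a).smul_mem z h2
      rw [Int.cast_natCast] at hz
      rw [← smul_incl_smul, ← map_smul (shiftSym (Zbar p) ht hr), ← Nat.cast_smul_eq_nsmul (Zbar p), smul_smul, hz, one_smul,
        map_sum, map_sum] at h3
      simp_rw [map_nsmul] at h3
      exact h3
  obtain ⟨z, rfl⟩ := sum_mono f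
  rw [map_sum, map_sum]
  refine sum_mem fun e he => ?_
  rw [map_smul, LinearMap.map_smulₛₗ, ← algebraMap_smul_sym]
  exact (negl p r a).smul_mem _ (hmono e (by simpa [Nat.lt_succ_iff] using he))

end Generation

/-! ### Dimension count for two coprime forms -/

section Dimension

variable {R : Type*} [CommRing R] {F : Type*} [Field F] {n i s r : ℕ}

lemma homogeneousComponent_mul_of_isHomogeneous {D : MvPolynomial (Fin 2) R}
    (hD : D.IsHomogeneous i) (q : MvPolynomial (Fin 2) R) :
    homogeneousComponent n (D * q) = if i ≤ n then D * homogeneousComponent (n - i) q else 0 := by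
  let : GradedAlgebra (homogeneousSubmodule (Fin 2) R) := MvPolynomial.gradedAlgebra
  have h := DirectSum.coe_decompose_mul_of_left_mem (homogeneousSubmodule (Fin 2) R) n hD (b := q)
  have hd : ∀ (φ : MvPolynomial (Fin 2) R) (k : ℕ),
      (DirectSum.decompose (homogeneousSubmodule (Fin 2) R) φ k : MvPolynomial (Fin 2) R) =
        homogeneousComponent k φ := fun φ k => decomposition.decompose'_apply φ k
  rwa [hd, hd] at h

/-- The alternative `f = 0` covers the case that the degree of `D` exceeds that of `f`, where `s -
i` is truncated. -/
lemma exists_mulSym_of_dvd {D : MvPolynomial (Fin 2) R} (hD : D.IsHomogeneous i)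
    {f : SymPow R s} (hf : D ∣ f.poly) :
    f = 0 ∨ ∃ (h : i + (s - i) = s) (q : SymPow R (s - i)), f = mulSym D hD h q := by
  obtain ⟨q, hq⟩ := hf
  have h1 := homogeneousComponent_mul_of_isHomogeneous (n := s) hD q
  rw [← hq, homogeneousComponent_of_mem f.isHomogeneous, if_pos rfl] at h1
  split_ifs at h1 with h
  · exact Or.inr ⟨Nat.add_sub_of_le h, SymPow.mk _ (homogeneousComponent_isHomogeneous _ q),
      SymPow.ext h1⟩
  · exact Or.inl (SymPow.ext h1)

lemma mono_coeff {e e' : ℕ} (he : e ≤ s) (he' : e' ≤ s) :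
    coeff (Finsupp.single 0 (s - e') + Finsupp.single 1 e') (mono R s e).poly =
      if e = e' then 1 else 0 := by
  rw [mono_poly _ he, X_pow_eq_monomial, X_pow_eq_monomial, monomial_mul, mul_one, coeff_monomial]
  refine if_congr ⟨fun h => ?_, ?_⟩ rfl rfl
  · simpa using DFunLike.congr_fun h 1
  · rintro rfl
    rfl

/-- The coordinates with respect to the monomials. -/
def symEquiv (s : ℕ) : (Fin (s + 1) → F) ≃ₗ[F] SymPow F s :=
  LinearEquiv.ofBijective (Fintype.linearCombination F fun e : Fin (s + 1) => mono F s e) (by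
    constructor
    · rw [injective_iff_map_eq_zero]
      intro c hc
      funext e
      have h := congrArg (fun f : SymPow F s =>
        coeff (Finsupp.single 0 (s - e) + Finsupp.single 1 (e : ℕ)) f.poly) hc
      simp only [Fintype.linearCombination_apply, map_sum, map_smul, coeff_sum, coeff_smul, map_zero,
        coeff_zero, smul_eq_mul] at h
      rw [Finset.sum_eq_single e] at h
      · rwa [mono_coeff (by omega) (by omega), if_pos rfl, mul_one] at h
      · intro e' _ hne
        rw [mono_coeff (by omega) (by omega), if_neg (fun h => hne (Fin.ext h)), mul_zero]
      · simp
    · intro f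
      obtain ⟨c, hc⟩ := sum_mono f
      refine ⟨fun e => c e, ?_⟩
      rw [Fintype.linearCombination_apply, hc, Finset.sum_range])

instance : Module.Finite F (SymPow F s) := Module.Finite.equiv (symEquiv s)

lemma finrank_symPow : Module.finrank F (SymPow F s) = s + 1 := by
  rw [← (symEquiv (F := F) s).finrank_eq, Module.finrank_fin_fun]

lemma mulSym_injective {D : MvPolynomial (Fin 2) F} (hD : D.IsHomogeneous i) (h : i + s = r)
    (hD0 : D ≠ 0) : Function.Injective (mulSym D hD h) := by
  intro f g hfg
  exact SymPow.ext (mul_left_cancel₀ hD0 (congrArg SymPow.poly hfg))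

/-- Every form of degree `r` is a combination of two given coprime forms if `r` is large. -/
lemma exists_mulSym_add_of_isRelPrime {h D : MvPolynomial (Fin 2) F} (hh : h.IsHomogeneous n)
    (hr : n + s = r) (hD : D.IsHomogeneous i) (hh0 : h ≠ 0) (hD0 : D ≠ 0) (hrel : IsRelPrime h D)
    (his : i ≤ s + 1) (hir : i ≤ r) (f : SymPow F r) :
    ∃ g : SymPow F s, D ∣ (f - mulSym h hh hr g).poly := by
  let U₁ : Submodule F (SymPow F r) := LinearMap.range (mulSym h hh hr)
  let U₂ : Submodule F (SymPow F r) := LinearMap.range (mulSym D hD (Nat.add_sub_of_le hir))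
  have h1 : Module.finrank F U₁ = s + 1 := by
    rw [LinearMap.finrank_range_of_inj (mulSym_injective hh hr hh0), finrank_symPow]
  have h2 : Module.finrank F U₂ = r - i + 1 := by
    rw [LinearMap.finrank_range_of_inj (mulSym_injective hD _ hD0), finrank_symPow]
  have hmem : ∀ x ∈ U₁ ⊓ U₂, ∃ g : SymPow F s, D ∣ g.poly ∧ mulSym h hh hr g = x := by
    rintro x ⟨⟨g, rfl⟩, ⟨q, hq⟩⟩
    refine ⟨g, hrel.symm.dvd_of_dvd_mul_left ⟨q.poly, ?_⟩, rfl⟩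
    exact (congrArg SymPow.poly hq).symm
  -- By coprimality an element of the intersection is `h g` with `D ∣ g`, so `g` ranges over the
  -- multiples of `D` of degree `s`; for `s < i` only `0` remains.
  have h3 : Module.finrank F (U₁ ⊓ U₂ : Submodule F (SymPow F r)) ≤ s + 1 - i := by
    rcases Nat.lt_or_ge s i with his' | his'
    · have : U₁ ⊓ U₂ = ⊥ := by
        rw [eq_bot_iff]
        intro x hx
        obtain ⟨g, hg, rfl⟩ := hmem x hx
        rcases exists_mulSym_of_dvd hD hg with rfl | ⟨h', -⟩
        · rw [map_zero]
          exact zero_mem _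
        · omega
      rw [this, finrank_bot]
      exact Nat.zero_le _
    · have hle : U₁ ⊓ U₂ ≤
          LinearMap.range ((mulSym h hh hr).comp (mulSym D hD (Nat.add_sub_of_le his'))) := by
        intro x hx
        obtain ⟨g, hg, rfl⟩ := hmem x hx
        rcases exists_mulSym_of_dvd hD hg with rfl | ⟨h', q, rfl⟩
        · rw [map_zero]
          exact zero_mem _
        · exact ⟨q, rfl⟩
      refine (Submodule.finrank_mono hle).trans ((LinearMap.finrank_range_le _).trans ?_)
      rw [finrank_symPow]
      omega
  have h4 := Submodule.finrank_sup_add_finrank_inf_eq U₁ U₂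
  -- `(s + 1) + (r - i + 1) - (s + 1 - i) = r + 1`, where `i ≤ s + 1` makes the truncated
  -- subtraction exact.
  have h5 : U₁ ⊔ U₂ = ⊤ := by
    apply Submodule.eq_top_of_finrank_eq
    refine le_antisymm (Submodule.finrank_le _) ?_
    rw [finrank_symPow]
    omega
  have hf : f ∈ U₁ ⊔ U₂ := h5 ▸ Submodule.mem_top
  obtain ⟨_, ⟨g, rfl⟩, _, ⟨q, rfl⟩, rfl⟩ := Submodule.mem_sup.1 hf
  exact ⟨g, q.poly, by rw [add_sub_cancel_left, mulSym_poly]⟩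

end Dimension

/-! ### Coprimality of the Dickson invariant and `θ` -/

section Coprime

variable {p : ℕ} [hp : Fact p.Prime]

lemma isRelPrime_X_pow (m n : ℕ) :
    IsRelPrime (X 0 ^ m : MvPolynomial (Fin 2) (Fbar p)) (X 1 ^ n) := by
  refine IsRelPrime.pow ?_
  rw [(X_prime (R := Fbar p) (i := (0 : Fin 2))).irreducible.isRelPrime_iff_not_dvd, X_dvd_X]
  simp

/-- The square of a common divisor divides `x^(p²) y - x y^(p²)`, so the divisor itself divides the
partial derivatives, which in characteristic `p` are `-y^(p²)` and `x^(p²)`. -/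
lemma isRelPrime_dicksonInv_dickson : IsRelPrime (dicksonInv (Fbar p) p) (dickson p) := by
  rintro z ⟨u, hu⟩ ⟨v, hv⟩
  have h : z * (z * (u * v)) = X 0 ^ p ^ 2 * X 1 - X 0 * X 1 ^ p ^ 2 := by
    have hE : dicksonInv (Fbar p) p * dickson p = X 0 ^ p ^ 2 * X 1 - X 0 * X 1 ^ p ^ 2 :=
      dicksonInv_mul (Fbar p) p hp.out.one_le
    rw [← hE, hu, hv]
    ring
  have hz : ∀ j, z ∣ pderiv j (z * (z * (u * v))) := by
    intro j
    rw [pderiv_mul, pderiv_mul]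
    exact dvd_add (Dvd.dvd.mul_left (dvd_mul_right _ _) _) (dvd_mul_right _ _)
  have hp0 : (p : MvPolynomial (Fin 2) (Fbar p)) = 0 := CharP.cast_eq_zero _ _
  have h0 := hz 0
  have h1 := hz 1
  rw [h] at h0 h1
  simp only [map_sub, pderiv_mul, pderiv_pow, pderiv_X_self, pderiv_X_of_ne (show (1 : Fin 2) ≠ 0 by decide),
    pderiv_X_of_ne (show (0 : Fin 2) ≠ 1 by decide), Nat.cast_pow, hp0, zero_pow two_ne_zero, zero_mul,
    mul_zero, add_zero, zero_add, one_mul, mul_one, zero_sub, sub_zero, dvd_neg] at h0 h1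
  exact isRelPrime_X_pow _ _ h1 h0

end Coprime

/-- The polynomial `x^p y - x y^p` over an arbitrary ring. -/
def dicksonOver (R : Type*) [CommRing R] (p : ℕ) : MvPolynomial (Fin 2) R :=
  X 0 ^ p * X 1 - X 0 * X 1 ^ p

lemma dicksonOver_isHomogeneous (p : ℕ) (R : Type*) [CommRing R] :
    (dicksonOver R p).IsHomogeneous (p + 1) := by
  refine IsHomogeneous.sub ((isHomogeneous_X_pow _ _).mul (isHomogeneous_X _ _)) ?_
  rw [add_comm]
  exact (isHomogeneous_X _ _).mul (isHomogeneous_X_pow _ _)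

/-! ### Multiples of `θ` and the induced map -/

section DicksonMultiples

variable {p : ℕ} [hp : Fact p.Prime] {r s c m n t d : ℕ} {a : Qbar p}

lemma map_dicksonOver : MvPolynomial.map (toRes p) (dicksonOver (Zbar p) p) = dickson p := by
  simp [dicksonOver, dickson]

lemma dickson_pow_isHomogeneous : (dickson p ^ m).IsHomogeneous (m * (p + 1)) := by
  rw [mul_comm]
  exact (dicksonOver_isHomogeneous p (Fbar p)).pow m

/-- In `θ = x y (x^(p - 1) - y^(p - 1))` each substitution makes one factor divisible by `p`: `y`
for `(1, 0; 0, p)`, `x` for `l = 0`, and the last factor for `l ≠ 0`. -/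
lemma natCast_dvd_subst_heckeMat_dicksonOver (i : Option (ZMod p)) :
    (p : MvPolynomial (Fin 2) (Zbar p)) ∣
      subst ((heckeMat p i)ᵀ.map (toZbar p)) (dicksonOver _ p) := by
  simp only [dicksonOver, map_sub, map_mul, map_pow]
  have hfac : ∀ x y : MvPolynomial (Fin 2) (Zbar p), x ^ p * y - x * y ^ p =
      x * y * (x ^ (p - 1) - y ^ (p - 1)) := by
    intro x y
    have h : ∀ k, x ^ (k + 1) * y - x * y ^ (k + 1) = x * y * (x ^ k - y ^ k) := fun k => by ring
    rw [← h, Nat.sub_add_cancel hp.out.one_le]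
  rw [hfac]
  cases i with
  | none =>
    rw [transpose_heckeMat_none, subst_heckeMat_none_X1]
    exact ((dvd_mul_right _ _).mul_left _).mul_right _
  | some l =>
    by_cases hl : l = 0
    · subst hl
      rw [subst_heckeMat_some_X0, teich_zero, map_zero, C_0, zero_mul, add_zero, mul_assoc,
        mul_assoc]
      exact dvd_mul_right _ _
    · rw [subst_heckeMat_some_X1]
      exact (natCast_dvd_subst_heckeMat_some_X0_pow_sub hl).mul_left _

lemma mapP_bracket_eq_zero_of_mem_fil (ha : a ≠ 0) (hn : (p : ℝ)⁻¹ ^ n < ‖a‖)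
    {v : SymPow (Fbar p) r} (hv : v ∈ fil p r n) (g : G p) : mapP p r a (bracket _ g v) = 0 := by
  rcases exists_mulSym_of_dvd dickson_pow_isHomogeneous hv with rfl | ⟨h, q, rfl⟩
  · rw [map_zero, map_zero]
  · obtain ⟨q, rfl⟩ := symMap_residue_surjective p _ q
    have hhom : (dicksonOver (Zbar p) p ^ n).IsHomogeneous (n * (p + 1)) := by
      rw [mul_comm]
      exact (dicksonOver_isHomogeneous p (Zbar p)).pow n
    have h1 : mulSym (dickson p ^ n) dickson_pow_isHomogeneous h (symMap (toRes p) _ q) =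
        symMap (toRes p) r (mulSym _ hhom h q) := by
      rw [symMap_mulSym]
      ext1
      rw [mulSym_poly, mulSym_poly, map_pow, map_dicksonOver]
    rw [h1]
    refine mapP_bracket_eq_zero ?_ g
    rw [← one_smul (Qbar p) (incl p r _)]
    refine smul_incl_mem_negl_of_heckeMat ha (n := n) (fun i => ?_) (by simpa using hn)
    rw [mulSym_poly, map_mul, map_pow]
    exact (pow_dvd_pow_of_dvd (natCast_dvd_subst_heckeMat_dicksonOver i) n).mul_right _

lemma shift_ne_zero : shift p t d (Fbar p) ≠ 0 := by
  refine pow_ne_zero _ fun h => ?_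
  have hp1 : p - 1 ≠ 0 := by
    have := hp.out.two_le
    omega
  -- At `(1, 0)` only the term `i = 0` survives, with value `1`.
  have h1 := congrArg (eval ![1, 0]) h
  rw [dicksonInv, Finset.sum_range_succ'] at h1
  simp [hp1] at h1

lemma exists_sub_shiftSym_mem_fil (ht : 1 ≤ t) (hr : r = s + p ^ t * (p - 1) * d)
    (hd : 1 ≤ d) (hm : m * (p + 1) ≤ s + 1) (v : SymPow (Fbar p) r) :
    ∃ u : SymPow (Fbar p) s, v - shiftSym (Fbar p) ht hr u ∈ fil p r m := by
  have hp2 := hp.out.two_le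
  have hpos : 0 < p ^ t * (p - 1) * d :=
    Nat.mul_pos (Nat.mul_pos (pow_pos hp.out.pos _) (by omega)) hd
  exact exists_mulSym_add_of_isRelPrime (shift_isHomogeneous (Fbar p) ht) (by rw [hr, add_comm])
    dickson_pow_isHomogeneous shift_ne_zero (pow_ne_zero _ (dickson_ne_zero p))
    (IsRelPrime.pow isRelPrime_dicksonInv_dickson) hm (by omega) v

lemma indFilIncl_bracket (g : G p) (v : fil p r m) :
    indFilIncl p r m (bracket _ g v) = bracket (symRep (toFbar p) r) g v.1 := by
  ext1
  funext x
  change (bracketFun (filRep p r m) g v x).1 = bracketFun _ g v.1 x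
  by_cases h : InCoset x g⁻¹
  · obtain ⟨κ, n, rfl⟩ := h
    rw [bracketFun_kz, bracketFun_kz]
    rfl
  · rw [bracketFun_of_not _ _ _ h, bracketFun_of_not _ _ _ h]
    rfl

lemma indFilProj_bracket (g : G p) (v : fil p r m) :
    indFilProj p r m n (bracket _ g v) =
      bracket (subquotRep p r m n) g (((fil p r n).submoduleOf (fil p r m)).mkQ v) := by
  ext1
  funext x
  change ((fil p r n).submoduleOf (fil p r m)).mkQ (bracketFun (filRep p r m) g v x) =
    bracketFun _ g _ x
  by_cases h : InCoset x g⁻¹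
  · obtain ⟨κ, n, rfl⟩ := h
    rw [bracketFun_kz, bracketFun_kz]
    rfl
  · rw [bracketFun_of_not _ _ _ h, bracketFun_of_not _ _ _ h, map_zero]

lemma indFilProj_surjective : Function.Surjective (indFilProj p r m n) := by
  intro f
  refine ind_induction (fun _ => True) (M := fun f => ∃ F, indFilProj p r m n F = f)
    ⟨0, map_zero _⟩ ?_ f (fun _ => trivial) trivial
  rintro _ g v - ⟨F, rfl⟩
  obtain ⟨w, rfl⟩ := Submodule.mkQ_surjective _ v
  exact ⟨F + bracket _ g w, by rw [map_add, indFilProj_bracket]⟩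

lemma mapP_indFilIncl_eq_zero (ha : a ≠ 0) (hn : (p : ℝ)⁻¹ ^ n < ‖a‖) (f : ind (filRep p r m))
    (hf : indFilProj p r m n f = 0) : mapP p r a (indFilIncl p r m f) = 0 := by
  refine ind_induction (fun v : fil p r m => v.1 ∈ fil p r n)
    (M := fun f => mapP p r a (indFilIncl p r m f) = 0) (by rw [map_zero, map_zero]) ?_ f
    (fun g => ?_) (zero_mem _)
  · intro f g v hv hf
    rw [map_add, map_add, hf, zero_add, indFilIncl_bracket]
    exact mapP_bracket_eq_zero_of_mem_fil ha hn hv g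
  · have h : ((fil p r n).submoduleOf (fil p r m)).mkQ (f.1 g) = 0 :=
      congrFun (congrArg Subtype.val hf) g
    rwa [Submodule.mkQ_apply, Submodule.Quotient.mk_eq_zero] at h

lemma mapP_indFilIncl_surjective
    (h : ∀ v : SymPow (Fbar p) r, ∃ w ∈ fil p r m, ∀ g, mapP p r a (bracket _ g (v - w)) = 0) :
    Function.Surjective fun f => mapP p r a (indFilIncl p r m f) := by
  intro x
  obtain ⟨f, rfl⟩ := mapP_surjective a x
  refine ind_induction (fun _ => True)
    (M := fun f => ∃ F, mapP p r a (indFilIncl p r m F) = mapP p r a f)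
    ⟨0, by rw [map_zero]⟩ ?_ f (fun _ => trivial) trivial
  rintro f g v - ⟨F, hF⟩
  obtain ⟨w, hw, hvw⟩ := h v
  refine ⟨F + bracket _ g ⟨w, hw⟩, ?_⟩
  have h1 := hvw g
  rw [map_sub, map_sub, sub_eq_zero] at h1
  rw [map_add, map_add, map_add, hF, h1, indFilIncl_bracket]

theorem exists_intertwiningMap (ha : a ≠ 0) (hn : (p : ℝ)⁻¹ ^ n < ‖a‖)
    (h : ∀ v : SymPow (Fbar p) r, ∃ w ∈ fil p r m, ∀ g, mapP p r a (bracket _ g (v - w)) = 0) :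
    ∃ φ : (indRep (subquotRep p r m n)).IntertwiningMap (thetaBarAction p r a),
      Function.Surjective φ ∧ ∀ f : ind (filRep p r m),
        φ (indFilProj p r m n f) = mapP p r a (indFilIncl p r m f) := by
  let L : ind (filRep p r m) →ₗ[Fbar p] ThetaBar p r a := (mapP p r a).comp (indFilIncl p r m)
  have hker : LinearMap.ker (indFilProj p r m n) ≤ LinearMap.ker L := fun f hf =>
    mapP_indFilIncl_eq_zero ha hn f hf
  let e := (indFilProj p r m n).quotKerEquivOfSurjective indFilProj_surjective
  let φ : ind (subquotRep p r m n) →ₗ[Fbar p] ThetaBar p r a :=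
    ((LinearMap.ker (indFilProj p r m n)).liftQ L hker).comp e.symm.toLinearMap
  have hφ : ∀ f, φ (indFilProj p r m n f) = mapP p r a (indFilIncl p r m f) := by
    intro f
    have h1 : e.symm (indFilProj p r m n f) = Submodule.Quotient.mk f := by
      rw [LinearEquiv.symm_apply_eq]
      rfl
    change (LinearMap.ker (indFilProj p r m n)).liftQ L hker (e.symm _) = _
    rw [h1, Submodule.liftQ_apply]
    rfl
  refine ⟨φ.intertwiningMap_of_isIntertwiningMap _ _ fun g f => ?_, fun x => ?_, hφ⟩
  · obtain ⟨f, rfl⟩ := indFilProj_surjective f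
    have h1 : indRep _ g (indFilProj p r m n f) = indFilProj p r m n (indRep _ g f) := rfl
    have h2 : indFilIncl p r m (indRep _ g f) = indRep _ g (indFilIncl p r m f) := rfl
    rw [h1, hφ, hφ, h2, mapP_indRep]
  · obtain ⟨f, hf⟩ := mapP_indFilIncl_surjective h x
    exact ⟨indFilProj p r m n f, (hφ f).trans hf⟩

end DicksonMultiples

/-! ### Translating slopes into norms, and the bound for `ε` -/

lemma inv_pow_eq_rpow (p n : ℕ) : (p : ℝ)⁻¹ ^ n = (p : ℝ) ^ (-(n : ℝ)) := by
  rw [Real.rpow_neg (Nat.cast_nonneg p), Real.rpow_natCast, inv_pow]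

section Slope

variable {p : ℕ} [hp : Fact p.Prime] {a : Qbar p}

lemma norm_eq_rpow_neg_nu (ha : a ≠ 0) : ‖a‖ = (p : ℝ) ^ (-nu p a) := by
  have hp1 : (1 : ℝ) < p := by exact_mod_cast hp.out.one_lt
  rw [nu, neg_neg, Real.rpow_logb (by linarith) hp1.ne' (norm_pos_iff.2 ha)]

lemma inv_pow_lt_norm_iff (ha : a ≠ 0) {n : ℕ} : (p : ℝ)⁻¹ ^ n < ‖a‖ ↔ nu p a < n := by
  have hp1 : (1 : ℝ) < p := by exact_mod_cast hp.out.one_lt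
  rw [norm_eq_rpow_neg_nu ha, inv_pow_eq_rpow, Real.rpow_lt_rpow_left_iff hp1, neg_lt_neg_iff]

lemma norm_lt_inv_pow_iff (ha : a ≠ 0) {n : ℕ} : ‖a‖ < (p : ℝ)⁻¹ ^ n ↔ n < nu p a := by
  have hp1 : (1 : ℝ) < p := by exact_mod_cast hp.out.one_lt
  rw [norm_eq_rpow_neg_nu ha, inv_pow_eq_rpow, Real.rpow_lt_rpow_left_iff hp1, neg_lt_neg_iff]

lemma norm_inv_pow_mul_lt_norm (ha : a ≠ 0) {c n : ℕ} (h : nu p a + c < n) :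
    ‖((p : Qbar p) ^ c)⁻¹‖ * (p : ℝ)⁻¹ ^ n < ‖a‖ := by
  have hp1 : (1 : ℝ) < p := by exact_mod_cast hp.out.one_lt
  rw [norm_inv, norm_pow, norm_natCast_p, norm_eq_rpow_neg_nu ha, inv_pow_eq_rpow, inv_pow_eq_rpow,
    ← Real.rpow_neg (by linarith), ← Real.rpow_add (by linarith), Real.rpow_lt_rpow_left_iff hp1]
  linarith

end Slope

/-- For `m = c - k` one has `m (p + 1) = m (p - 1) + 2 m`, so the claim is `2 m ≤ b + k (p - 1) +
1`. This is the defining inequality for `k = 0, 1`; for `k = 2` it follows from `c ≤ p - 2`. -/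
lemma sub_eps_mul_le {p b c : ℕ} (hp : 1 ≤ p) (hc : c ≤ p - 2) :
    (c - eps p b c) * (p + 1) ≤ b + c * (p - 1) + 1 := by
  obtain ⟨q, rfl⟩ : ∃ q, p = q + 1 := ⟨p - 1, by omega⟩
  have key : ∀ m k : ℕ, (m = 0 ∨ c = m + k) → 2 * m ≤ b + k * q + 1 →
      m * (q + 1 + 1) ≤ b + c * (q + 1 - 1) + 1 := by
    rintro m k (rfl | rfl) h
    · simp
    · rw [Nat.add_sub_cancel, Nat.mul_succ, Nat.mul_succ, add_mul]
      omega
  unfold eps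
  split_ifs
  · exact key _ 0 (by omega) (by omega)
  · exact key _ 1 (by omega) (by omega)
  · exact key _ 2 (by omega) (by omega)

end LocalConstancy

end

/-! ### The main theorem -/

open LocalConstancy
theorem mainTheorem3 (p : ℕ) [Fact p.Prime] (hp : 7 ≤ p) (b c t d s r : ℕ)
    (hb : 2 ≤ b) (hbp : b ≤ p) (hc : c ≤ p - 2) (hd : ¬ p ∣ d)
    (hs : s = b + c * (p - 1)) (hr : r = s + p ^ t * (p - 1) * d) (hsc : 2 * c ≤ s)
    (a : PadicAlgCl p) (ha : a ≠ 0) (hca : (c : ℝ) < nu p a) (hap : nu p a < (p : ℝ) - 1)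
    (ht : 2 * nu p a ≤ (t : ℝ)) :
    ∃ φ : (indRep (subquotRep p r (c - eps p b c) (⌊nu p a⌋₊ + 1))).IntertwiningMap
        (thetaBarAction p r a),
      Function.Surjective φ ∧
      ∀ f : ind (filRep p r (c - eps p b c)),
        φ (indFilProj p r (c - eps p b c) (⌊nu p a⌋₊ + 1) f) =
          mapP p r a (indFilIncl p r (c - eps p b c) f) := by
  refine exists_intertwiningMap ha ((inv_pow_lt_norm_iff ha).2 ?_) fun v => ?_
  · push_cast
    exact Nat.lt_floor_add_one _
  -- For `c = 0` the subrepresentation is all of `V_r`.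
  rcases Nat.eq_zero_or_pos c with rfl | hc1
  · refine ⟨v, ?_, fun g => by rw [sub_self, map_zero, map_zero]⟩
    rw [Nat.zero_sub]
    change dickson p ^ 0 ∣ v.poly
    rw [pow_zero]
    exact one_dvd _
  have hc0 : (0 : ℝ) ≤ c := Nat.cast_nonneg c
  have hct : c < t := by
    have : (c : ℝ) < t := by linarith
    exact_mod_cast this
  have hd1 : 1 ≤ d := Nat.pos_of_ne_zero fun h => hd (h ▸ dvd_zero p)
  have hpt : p ≤ p ^ t := Nat.le_self_pow (by omega) p
  have hs' : p + c ≤ s := by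
    obtain ⟨q, rfl⟩ : ∃ q, p = q + 2 := ⟨p - 2, by omega⟩
    have : 1 * q ≤ c * q := Nat.mul_le_mul_right q hc1
    have h2 : c * (q + 2 - 1) = c * q + c := by
      rw [show q + 2 - 1 = q + 1 by omega, Nat.mul_succ]
    omega
  have hr' : c + (c + 1) * (p - 1) + (c + 1) ≤ r := by
    have h1 : p * (p - 1) * 1 ≤ p ^ t * (p - 1) * d :=
      Nat.mul_le_mul (Nat.mul_le_mul_right _ hpt) hd1
    have h2 : 3 * (p - 1) ≤ p * (p - 1) := Nat.mul_le_mul_right _ (by omega)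
    rw [Nat.succ_mul]
    omega
  have hm : (c - eps p b c) * (p + 1) ≤ s + 1 := by
    rw [hs]
    exact sub_eps_mul_le (by omega) hc
  obtain ⟨u, hu⟩ := exists_sub_shiftSym_mem_fil (by omega) hr hd1 hm v
  refine ⟨_, hu, fun g => ?_⟩
  obtain ⟨u, rfl⟩ := symMap_residue_surjective p _ u
  rw [sub_sub_cancel, ← symMap_shiftSym]
  refine mapP_bracket_eq_zero ?_ g
  -- The first source needs `ν(a) + c < n` with `n ≤ t` and `n ≤ s`. Indeed `ν(a) + c < 2 ν(a) ≤ t`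
  -- and `ν(a) + c < p + c ≤ s`.
  refine incl_shiftSym_mem_negl ha ((norm_lt_inv_pow_iff ha).2 hca) hc1 (by omega) hb hbp hs
    (by omega) hr hct hr' (n := min t s) (min_le_left _ _) (min_le_right _ _)
    (norm_inv_pow_mul_lt_norm ha ?_) u
  rw [Nat.cast_min, lt_min_iff]
  have hs'' : (p : ℝ) + c ≤ s := by exact_mod_cast hs'
  exact ⟨by linarith, by linarith⟩
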